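/- Let $k$ be an algebraically closed field of characteristic $0$, and let $t,r,e$ be positive integers. Let $Z_1,\dots,Z_r$ be non-empty $0$-dimensional connected subschemes of the germ $\mathbf A^2_0$ of the affine plane at the origin $O$. A subscheme $W$ of $\mathbf P^2$ supported at one point $P$ is called equivalent to $Z_i$ if there is a formal isomorphism (over $k$) from the germ $\mathbf A^2_0$ to the germ of $\mathbf P^2$ at $P$ which sends $Z_i$ onto $W$. Let $\operatorname{mult}_0(Z_i)$ be the least integer $n$ such that $Z_i$ is contained in the fat point $nO$ (the subscheme with ideal $I_{O}^{\,n}$), let $\operatorname{length}(Z_i)=\dim_k H^0(Z_i,\mathcal O_{Z_i})$, and put $m:=\max\{2,\operatorname{mult}_0(Z_1),\dots,\operatorname{mult}_0(Z_r)\}$. Assume $$\frac{(t+2)(t+1)}{2}\ \ge\ 1+3e+\sum_{i=1}^{r}\operatorname{length}(Z_i)\qquad\text{and}\qquad e\ \ge\ \frac{(m-1)(t-1)}{2}.$$ Then for a general union $Z\subset\mathbf P^2$ of $e$ double points $2P_1,\dots,2P_e$ and $r$ subschemes $W_1,\dots,W_r$, with $W_i$ equivalent to $Z_i$ for every $i$,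 one has $h^1(\mathbf P^2,\mathcal I_Z(t))=0$. Here "general" means: for all choices of the points $P_j$ and of the formal isomorphisms defining the $W_i$ in some non-empty Zariski open subset of the irreducible space of all such choices (a condition on the points and on finite jets of the isomorphisms). -/

import Mathlib

namespace FatPoints

/-!
Conventions. `k` is the ground field, `ℙ²` is the projective plane over `k` with homogeneous
coordinate ring `k[X₀, X₁, X₂] = MvPolynomial (Fin 3) k`, and the formal germ of the affine plane
at the origin `O` is the formal spectrum of `k⟦x, y⟧ = MvPowerSeries (Fin 2) k`.
-/

noncomputable section

/-! ### Zero-dimensional connected subschemes of the germ of the plane at the origin -/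

/-- An ideal of `k⟦x, y⟧` defines a (non-empty) zero-dimensional connected subscheme of the germ of
the plane at `O`: it is proper and has finite colength. (Such ideals are the same thing as proper
ideals of finite colength of the local ring of the affine plane at `O`.) -/
def IsZeroDimGerm {k : Type*} [Field k] (I : Ideal (MvPowerSeries (Fin 2) k)) : Prop :=
  I ≠ ⊤ ∧ Module.Finite k (MvPowerSeries (Fin 2) k ⧸ I)

/-- The length `dim_k (k⟦x, y⟧ / I)` of the subscheme defined by `I`. -/
def germLength {k : Type*} [Field k] (I : Ideal (MvPowerSeries (Fin 2) k)) : ℕ :=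
  Module.finrank k (MvPowerSeries (Fin 2) k ⧸ I)

/-- The multiplicity of the subscheme `Z` defined by `I`: the least `m` such that `Z` is contained
in the fat point `mO`, the subscheme defined by the `m`-th power of the maximal ideal. -/
def germMult {k : Type*} [Field k] (I : Ideal (MvPowerSeries (Fin 2) k)) : ℕ :=
  sInf {m : ℕ | IsLocalRing.maximalIdeal (MvPowerSeries (Fin 2) k) ^ m ≤ I}

/-! ### Closed subschemes of the projective plane, given by homogeneous ideals -/

/-- The homogeneous ideal of the point of `ℙ²` with homogeneous coordinates `q ≠ 0`: it is generated
by the forms vanishing at `q`. -/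
def pointIdeal {k : Type*} [Field k] (q : Fin 3 → k) : Ideal (MvPolynomial (Fin 3) k) :=
  Ideal.span {G | (∃ d, G.IsHomogeneous d) ∧ MvPolynomial.eval q G = 0}

/-- A homogeneous ideal defining the fat point `mP`, where `P` has homogeneous coordinates `q`. -/
def fatPointIdeal {k : Type*} [Field k] (m : ℕ) (q : Fin 3 → k) :
    Ideal (MvPolynomial (Fin 3) k) :=
  pointIdeal q ^ m

/-- A triple `F = (F₀, F₁, F₂)` of power series in `x, y` defines (as homogeneous coordinates) a
formal isomorphism from the germ of the affine plane at `O` to the germ of `ℙ²` at the point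
`P = [F₀(0) : F₁(0) : F₂(0)]`. This means that `F(0) ≠ 0` and that the differential at `O` of the
resulting map to `ℙ²` is invertible; both are expressed by the linear independence of the vectors
`F(0)`, `∂F/∂x(0)` and `∂F/∂y(0)`. Every formal isomorphism from the germ of the plane at `O` to
the germ of `ℙ²` at a `k`-rational point is given by such a triple, unique up to multiplication by
a unit of `k⟦x, y⟧`. -/
def IsFormalIso {k : Type*} [Field k] (F : Fin 3 → MvPowerSeries (Fin 2) k) : Prop :=
  LinearIndependent k
    ![fun i => MvPowerSeries.coeff 0 (F i),
      fun i => MvPowerSeries.coeff (Finsupp.single 0 1) (F i),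
      fun i => MvPowerSeries.coeff (Finsupp.single 1 1) (F i)]

/-- The homogeneous ideal of the image `W ⊆ ℙ²` of the subscheme defined by `I` under the formal
isomorphism given by `F`. It is generated by the forms `G` whose pullback `G(F₀, F₁, F₂)` lies
in `I`. The subschemes of `ℙ²` equivalent to the one defined by `I` are exactly these `W`. -/
def imageIdeal {k : Type*} [Field k] (F : Fin 3 → MvPowerSeries (Fin 2) k)
    (I : Ideal (MvPowerSeries (Fin 2) k)) : Ideal (MvPolynomial (Fin 3) k) :=
  Ideal.span {G | (∃ d, G.IsHomogeneous d) ∧ MvPolynomial.aeval F G ∈ I}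

/-! ### Cohomology of the sheaf `I_Z(t)`

For a homogeneous ideal `J` with associated ideal sheaf `I_Z` we use the Čech complex of `I_Z(t)`
for the standard covering of `ℙ²` by the three affine open sets `Uᵢ = {Xᵢ ≠ 0}`. All groups of
sections are realized inside the field of fractions of `k[X₀, X₁, X₂]`, and then the restriction
maps are inclusions. -/

/-- The sections of `I_Z(t)` over the open set where all `Xᵢ`, `i ∈ S`, are non-zero: the fractions
`G / (∏ i ∈ S, Xᵢ) ^ n`, homogeneous of degree `t`, with numerator `G` in `J`. -/
def sections {k : Type*} [Field k] (J : Ideal (MvPolynomial (Fin 3) k)) (t : ℕ)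
    (S : Finset (Fin 3)) : Submodule k (FractionRing (MvPolynomial (Fin 3) k)) where
  carrier := {s | ∃ n : ℕ, ∃ G ∈ J, G.IsHomogeneous (t + n * S.card) ∧
    s * algebraMap (MvPolynomial (Fin 3) k) (FractionRing (MvPolynomial (Fin 3) k))
        ((∏ i ∈ S, MvPolynomial.X i) ^ n) =
      algebraMap (MvPolynomial (Fin 3) k) (FractionRing (MvPolynomial (Fin 3) k)) G}
  zero_mem' := ⟨0, 0, J.zero_mem, MvPolynomial.isHomogeneous_zero _ _ _, by simp⟩
  add_mem' := by
    rintro a b ⟨n, G, hG, hGh, ha⟩ ⟨m, H, hH, hHh, hb⟩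
    have hX : ∀ l : ℕ, ((∏ i ∈ S, MvPolynomial.X i : MvPolynomial (Fin 3) k) ^ l).IsHomogeneous
        (l * S.card) := by
      intro l
      have h1 : (∏ i ∈ S, MvPolynomial.X i : MvPolynomial (Fin 3) k).IsHomogeneous S.card := by
        have h2 := MvPolynomial.IsHomogeneous.prod S
          (fun i => (MvPolynomial.X i : MvPolynomial (Fin 3) k)) (fun _ => 1)
          (fun i _ => MvPolynomial.isHomogeneous_X k i)
        simpa using h2
      have h3 := h1.pow l
      rwa [mul_comm] at h3
    refine ⟨n + m, G * (∏ i ∈ S, MvPolynomial.X i) ^ m + H * (∏ i ∈ S, MvPolynomial.X i) ^ n,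
      J.add_mem (J.mul_mem_right _ hG) (J.mul_mem_right _ hH), ?_, ?_⟩
    · refine MvPolynomial.IsHomogeneous.add ?_ ?_
      · have h4 := hGh.mul (hX m)
        rwa [add_assoc, ← add_mul] at h4
      · have h4 := hHh.mul (hX n)
        rwa [add_assoc, ← add_mul, add_comm m n] at h4
    · rw [map_add, map_mul, map_mul, ← ha, ← hb, pow_add, map_mul]
      ring
  smul_mem' := by
    rintro c a ⟨n, G, hG, hGh, ha⟩
    refine ⟨n, c • G, ?_, ?_, ?_⟩
    · rw [MvPolynomial.smul_eq_C_mul]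
      exact J.mul_mem_left _ hG
    · exact (MvPolynomial.homogeneousSubmodule (Fin 3) k _).smul_mem c hGh
    · rw [smul_mul_assoc, ha, Algebra.smul_def, Algebra.smul_def, map_mul,
        ← IsScalarTower.algebraMap_apply]

/-- Čech `1`-cocycles: families `c i j` of sections over `Uᵢ ∩ Uⱼ` with `c i j + c j l = c i l`
on `Uᵢ ∩ Uⱼ ∩ Uₗ`. (In particular `c i i = 0` and `c j i = - c i j`.) -/
def cocycles {k : Type*} [Field k] (J : Ideal (MvPolynomial (Fin 3) k)) (t : ℕ) :
    Submodule k (Fin 3 → Fin 3 → FractionRing (MvPolynomial (Fin 3) k)) where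
  carrier := {c | (∀ i j, c i j ∈ sections J t {i, j}) ∧ ∀ i j l, c i j + c j l = c i l}
  zero_mem' := ⟨fun _ _ => Submodule.zero_mem _, fun _ _ _ => by simp⟩
  add_mem' := by
    rintro a b ⟨ha, ha'⟩ ⟨hb, hb'⟩
    refine ⟨fun i j => Submodule.add_mem _ (ha i j) (hb i j), fun i j l => ?_⟩
    simp only [Pi.add_apply, ← ha' i j l, ← hb' i j l]
    ring
  smul_mem' := by
    rintro c a ⟨ha, ha'⟩
    refine ⟨fun i j => Submodule.smul_mem _ c (ha i j), fun i j l => ?_⟩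
    simp only [Pi.smul_apply, ← ha' i j l, smul_add]

/-- Čech `1`-coboundaries: families `s j - s i`, where `s i` is a section over `Uᵢ`. -/
def coboundaries {k : Type*} [Field k] (J : Ideal (MvPolynomial (Fin 3) k)) (t : ℕ) :
    Submodule k (Fin 3 → Fin 3 → FractionRing (MvPolynomial (Fin 3) k)) where
  carrier := {c | ∃ s : Fin 3 → FractionRing (MvPolynomial (Fin 3) k),
    (∀ i, s i ∈ sections J t {i}) ∧ ∀ i j, c i j = s j - s i}
  zero_mem' := ⟨0, fun _ => Submodule.zero_mem _, fun _ _ => by simp⟩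
  add_mem' := by
    rintro a b ⟨s, hs, hs'⟩ ⟨u, hu, hu'⟩
    refine ⟨s + u, fun i => Submodule.add_mem _ (hs i) (hu i), fun i j => ?_⟩
    simp only [Pi.add_apply, hs' i j, hu' i j]
    ring
  smul_mem' := by
    rintro c a ⟨s, hs, hs'⟩
    refine ⟨c • s, fun i => Submodule.smul_mem _ c (hs i), fun i j => ?_⟩
    simp only [Pi.smul_apply, hs' i j, smul_sub]

/-- The cohomology space `H¹(ℙ², I_Z(t))`, where `Z` is the closed subscheme defined by `J`.
(Coboundaries are cocycles, so this is the usual quotient.) -/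
abbrev H1 {k : Type*} [Field k] (J : Ideal (MvPolynomial (Fin 3) k)) (t : ℕ) : Type _ :=
  cocycles J t ⧸ (coboundaries J t).submoduleOf (cocycles J t)

/-- `h¹(ℙ², I_Z(t))`, as a cardinal. -/
def h1 {k : Type*} [Field k] (J : Ideal (MvPolynomial (Fin 3) k)) (t : ℕ) : Cardinal :=
  Module.rank k (H1 J t)

/-! ### General unions -/

/-- The data of `e` points of `ℙ²`, given by homogeneous coordinates, and of `r` formal isomorphisms
from the germ of the plane at `O` to germs of `ℙ²`. -/
structure Configuration (k : Type*) [Field k] (e r : ℕ) where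
  point : Fin e → Fin 3 → k
  point_ne_zero : ∀ j, point j ≠ 0
  iso : Fin r → Fin 3 → MvPowerSeries (Fin 2) k
  isFormalIso : ∀ i, IsFormalIso (iso i)

/-- The parameters of a configuration: the homogeneous coordinates of the points and all
coefficients of the power series that define the formal isomorphisms. -/
def Configuration.coord {k : Type*} [Field k] {e r : ℕ} (c : Configuration k e r) :
    (Fin e × Fin 3) ⊕ (Fin r × Fin 3 × (Fin 2 →₀ ℕ)) → k
  | Sum.inl (j, a) => c.point j a
  | Sum.inr (i, a, d) => MvPowerSeries.coeff d (c.iso i a)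

/-- A property holds for a general configuration: it holds at all points of a non-empty principal
Zariski open subset of the (irreducible) space of configurations. The polynomial `Φ` involves only
finitely many parameters, that is, the points and finite jets of the isomorphisms. -/
def ForGeneral {k : Type*} [Field k] {e r : ℕ} (p : Configuration k e r → Prop) : Prop :=
  ∃ Φ : MvPolynomial ((Fin e × Fin 3) ⊕ (Fin r × Fin 3 × (Fin 2 →₀ ℕ))) k,
    (∃ c : Configuration k e r, MvPolynomial.eval c.coord Φ ≠ 0) ∧
      ∀ c : Configuration k e r, MvPolynomial.eval c.coord Φ ≠ 0 → p c

/-- The ideal of the union in `ℙ²` of the double points `2Pⱼ` at the points of the configuration and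
of the images `Wᵢ` of the subschemes defined by `I i` under its formal isomorphisms. -/
def Configuration.unionIdeal {k : Type*} [Field k] {e r : ℕ} (c : Configuration k e r)
    (I : Fin r → Ideal (MvPowerSeries (Fin 2) k)) : Ideal (MvPolynomial (Fin 3) k) :=
  (⨅ j, fatPointIdeal 2 (c.point j)) ⊓ ⨅ i, imageIdeal (c.iso i) (I i)

end

end FatPoints

/-!
The theorem is an interpolation problem. If the forms of degree `t` surject onto the product of the
quotients `k⟦x, y⟧ / I_v` attached to the double points and to the given subschemes, then
`h¹(ℙ², I_Z(t)) = 0`: a cocycle of `I_Z(t)` is a coboundary of `𝒪(t)`, because powers of the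
coordinates form a regular sequence, and a form of degree `t` that interpolates the resulting local
sections corrects it to a coboundary of `I_Z(t)` (`h1_eq_zero`). Surjectivity is an open condition,
given by a determinant in finitely many coefficients, so that one configuration with this property
suffices (`forGeneral_of_exists`). Such a configuration exists even with translations as formal
isomorphisms: one looks for points of the affine plane at which the polynomials of degree at
most `t` interpolate.

The conditions are imposed one after the other on a shrinking space `V` of polynomials. The torus
degenerates `V` to the span of its initial monomials, whose set `A` of exponents lies in the
triangle of side `t` and has `dim V` elements. By semicontinuity (`Imposes.of_initials`), conditions
of fat points that are independent on the monomials are independent on `V`. On the monomials with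
exponents in `A`, an `n`-fold point at `(1, 1)` imposes independent conditions if and only if no
curve of degree less than `n` contains `A`, as the Taylor coefficients at `(1, 1)` of
`x ^ a * y ^ b` are products of binomial coefficients in `a` and `b`. By the Schwartz–Zippel lemma
this holds as soon as `(n - 1) * (t + 1) < dim V`, and the room kept for the `e` double points makes this inequality
true for each of the given subschemes (`exists_imposes_single`, `room_of_bounds`).

For the double points (`exists_imposes_double`) the only obstruction is a line that contains too
many exponents of `A`. As long as every line contains fewer than twice as many exponents as there
are double points left, one more of them can be placed, and what is left of `A` still has enough
exponents outside each line. Once a line contains that many, all remaining points are placed on a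
monomial curve, where the problem splits into two problems on univariate polynomials
(`exists_imposes_double_of_line`). Finally, a line contains at most `t + 1` exponents, which is
enough unless the numerical bounds are almost attained; in that case the first subscheme, placed at
the origin, and a second one, placed outside the line `y = 0`, exclude the exponents `(0, 0)` and
`(0, t)`, so that no line contains more than `t` exponents of `A`.
-/

namespace FatPoints

/-! ### Powers of the maximal ideal of `k⟦x, y⟧` -/

theorem natCast_le_order_of_mem_maximalIdeal_pow {k : Type*} [Field k] {n : ℕ}
    {g : MvPowerSeries (Fin 2) k}
    (hg : g ∈ IsLocalRing.maximalIdeal (MvPowerSeries (Fin 2) k) ^ n) : (n : ℕ∞) ≤ g.order := by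
  induction n generalizing g with
  | zero => simp
  | succ n ih =>
    rw [pow_succ] at hg
    refine Submodule.mul_induction_on hg (fun a ha b hb => ?_) (fun a b ha hb => ?_)
    · have hb' : (1 : ℕ∞) ≤ b.order := by
        rw [MvPowerSeries.one_le_order_iff_constCoeff_eq_zero]
        rw [IsLocalRing.mem_maximalIdeal, mem_nonunits_iff,
          MvPowerSeries.isUnit_iff_constantCoeff] at hb
        simpa using hb
      push_cast
      exact (add_le_add (ih ha) hb').trans MvPowerSeries.le_order_mul
    · exact (le_min ha hb).trans MvPowerSeries.min_order_le_add

theorem X_mem_maximalIdeal {k : Type*} [Field k] (i : Fin 2) :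
    (MvPowerSeries.X i : MvPowerSeries (Fin 2) k) ∈
      IsLocalRing.maximalIdeal (MvPowerSeries (Fin 2) k) := by
  rw [IsLocalRing.mem_maximalIdeal, mem_nonunits_iff, MvPowerSeries.isUnit_iff_constantCoeff]
  simp

theorem mem_maximalIdeal_pow_of_le_order {k : Type*} [Field k] {n : ℕ}
    {g : MvPowerSeries (Fin 2) k} (hg : (n : ℕ∞) ≤ g.order) :
    g ∈ IsLocalRing.maximalIdeal (MvPowerSeries (Fin 2) k) ^ n := by
  induction n generalizing g with
  | zero => simp
  | succ n ih =>
    have hc : ∀ d : Fin 2 →₀ ℕ, d.degree < n + 1 → MvPowerSeries.coeff d g = 0 := fun d hd =>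
      MvPowerSeries.coeff_of_lt_order (lt_of_lt_of_le (by exact_mod_cast hd) hg)
    let g₁ : MvPowerSeries (Fin 2) k := fun d => MvPowerSeries.coeff (Finsupp.single 0 1 + d) g
    let g₂ : MvPowerSeries (Fin 2) k := fun d =>
      if d 0 = 0 then MvPowerSeries.coeff (Finsupp.single 1 1 + d) g else 0
    have h₁ : ∀ d, MvPowerSeries.coeff d g₁ = MvPowerSeries.coeff (Finsupp.single 0 1 + d) g :=
      fun _ => rfl
    have h₂ : ∀ d, MvPowerSeries.coeff d g₂ =
      if d 0 = 0 then MvPowerSeries.coeff (Finsupp.single 1 1 + d) g else 0 := fun _ => rfl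
    have hg12 : g = g₁ * MvPowerSeries.X 0 + g₂ * MvPowerSeries.X 1 := by
      ext d
      rw [mul_comm g₁, mul_comm g₂, map_add, MvPowerSeries.X, MvPowerSeries.X,
        MvPowerSeries.coeff_monomial_mul, MvPowerSeries.coeff_monomial_mul, h₁, h₂]
      simp only [one_mul, Finsupp.single_le_iff]
      by_cases h0 : 1 ≤ d 0
      · have h3 : Finsupp.single 0 1 + (d - Finsupp.single 0 1) = d :=
          add_tsub_cancel_of_le (by simpa using h0)
        have h4 : (d - Finsupp.single 1 1 : Fin 2 →₀ ℕ) 0 ≠ 0 := by simp; omega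
        simp only [h0, h3, h4, if_true, if_false, ite_self, add_zero]
      · have h4 : (d - Finsupp.single 1 1 : Fin 2 →₀ ℕ) 0 = 0 := by simp; omega
        by_cases h5 : 1 ≤ d 1
        · have h3 : Finsupp.single 1 1 + (d - Finsupp.single 1 1) = d :=
            add_tsub_cancel_of_le (by simpa using h5)
          simp [h0, h5, h3, h4]
        · have h6 : d = 0 := by
            ext i; fin_cases i <;> simp <;> omega
          simp only [h0, h5, if_false, add_zero]
          exact hc d (by simp [h6])
    rw [hg12, pow_succ]
    refine Ideal.add_mem _ (Ideal.mul_mem_mul (ih ?_) (X_mem_maximalIdeal 0))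
      (Ideal.mul_mem_mul (ih ?_) (X_mem_maximalIdeal 1))
    · refine MvPowerSeries.nat_le_order fun d hd => ?_
      rw [h₁]
      exact hc _ (by rw [map_add, Finsupp.degree_single]; omega)
    · refine MvPowerSeries.nat_le_order fun d hd => ?_
      rw [h₂]
      split_ifs
      · exact hc _ (by rw [map_add, Finsupp.degree_single]; omega)
      · rfl

/-- The `n`-th power of the maximal ideal of `k⟦x, y⟧` consists of the series without terms of
degree less than `n`. -/
theorem mem_maximalIdeal_pow_iff {k : Type*} [Field k] {n : ℕ} {g : MvPowerSeries (Fin 2) k} :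
    g ∈ IsLocalRing.maximalIdeal (MvPowerSeries (Fin 2) k) ^ n ↔
      ∀ d : Fin 2 →₀ ℕ, d.degree < n → MvPowerSeries.coeff d g = 0 :=
  ⟨fun h _ hd => MvPowerSeries.coeff_of_lt_order (lt_of_lt_of_le (by exact_mod_cast hd)
    (natCast_le_order_of_mem_maximalIdeal_pow h)),
  fun h => mem_maximalIdeal_pow_of_le_order (MvPowerSeries.nat_le_order h)⟩

/-! ### The Čech complex -/

section Cech

open MvPolynomial

theorem isHomogeneous_divMonomial {k : Type*} [Field k] {t n : ℕ} (i : Fin 3)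
    {H : MvPolynomial (Fin 3) k} (hH : H.IsHomogeneous (t + n)) :
    (divMonomial H (Finsupp.single i n)).IsHomogeneous t := by
  intro d hd
  rw [coeff_divMonomial] at hd
  have h1 := hH hd
  simp only [map_add, Finsupp.weight_single] at h1
  simp at h1
  omega

/-- The regular-sequence property of the powers of the coordinates that gives `H¹(ℙ², 𝒪(t)) = 0`. -/
theorem exists_eq_mul_X_pow_add {k : Type*} [Field k] {a b c : Fin 3} (hac : a ≠ c) (hbc : b ≠ c)
    {t n : ℕ} {G A B : MvPolynomial (Fin 3) k} (hG : G.IsHomogeneous (t + n))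
    (h : G * X c ^ n = A * X a ^ n + B * X b ^ n) :
    ∃ A' B' : MvPolynomial (Fin 3) k, A'.IsHomogeneous t ∧ B'.IsHomogeneous t ∧
      G = A' * X a ^ n + B' * X b ^ n := by
  set R := modMonomial G (Finsupp.single a n) with hR
  have hGR := divMonomial_add_modMonomial G (Finsupp.single a n)
  rw [← hR] at hGR
  have hRh : R.IsHomogeneous (t + n) := by
    intro d hd
    by_cases hle : Finsupp.single a n ≤ d
    · exact absurd (coeff_modMonomial_of_le G hle) hd
    · rw [hR, coeff_modMonomial_of_not_le G hle] at hd
      exact hG hd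
  have hRb : modMonomial R (Finsupp.single b n) = 0 := by
    ext d
    rw [coeff_zero]
    by_cases hbd : Finsupp.single b n ≤ d
    · exact coeff_modMonomial_of_le R hbd
    rw [coeff_modMonomial_of_not_le R hbd]
    by_cases had : Finsupp.single a n ≤ d
    · exact coeff_modMonomial_of_le G had
    rw [hR, coeff_modMonomial_of_not_le G had]
    have h1 := congrArg (coeff (d + Finsupp.single c n)) h
    rw [coeff_add, X_pow_eq_monomial, X_pow_eq_monomial, X_pow_eq_monomial, coeff_mul_monomial,
      coeff_mul_monomial', coeff_mul_monomial', if_neg, if_neg] at h1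
    · simpa using h1
    · intro h2
      refine hbd ?_
      rw [Finsupp.single_le_iff] at h2 ⊢
      simpa [Finsupp.single_apply, hbc.symm] using h2
    · intro h2
      refine had ?_
      rw [Finsupp.single_le_iff] at h2 ⊢
      simpa [Finsupp.single_apply, hac.symm] using h2
  have hRB := divMonomial_add_modMonomial R (Finsupp.single b n)
  rw [hRb, add_zero] at hRB
  refine ⟨_, _, isHomogeneous_divMonomial a hG, isHomogeneous_divMonomial b hRh, ?_⟩
  rw [X_pow_eq_monomial, X_pow_eq_monomial, mul_comm _ (monomial _ _), mul_comm _ (monomial _ _),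
    hRB, hGR]

/-- A section has numerators for all sufficiently large exponents of the denominator. -/
theorem exists_numerator {k : Type*} [Field k] {J : Ideal (MvPolynomial (Fin 3) k)} {t : ℕ}
    {S : Finset (Fin 3)} {s : FractionRing (MvPolynomial (Fin 3) k)} (hs : s ∈ sections J t S) :
    ∃ n, ∀ m, n ≤ m → ∃ G ∈ J, G.IsHomogeneous (t + m * S.card) ∧
      s * algebraMap (MvPolynomial (Fin 3) k) (FractionRing (MvPolynomial (Fin 3) k))
        ((∏ i ∈ S, X i) ^ m) = algebraMap (MvPolynomial (Fin 3) k) _ G := by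
  obtain ⟨n, G, hG, hGh, h⟩ := hs
  refine ⟨n, fun m hm => ⟨G * (∏ i ∈ S, X i) ^ (m - n), J.mul_mem_right _ hG, ?_, ?_⟩⟩
  · have h1 : (∏ i ∈ S, X i : MvPolynomial (Fin 3) k).IsHomogeneous S.card := by
      simpa using IsHomogeneous.prod S (fun i => (X i : MvPolynomial (Fin 3) k)) (fun _ => 1)
        (fun i _ => isHomogeneous_X k i)
    have h2 := hGh.mul (h1.pow (m - n))
    have h3 : t + n * S.card + S.card * (m - n) = t + m * S.card := by
      obtain ⟨l, rfl⟩ := Nat.exists_eq_add_of_le hm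
      rw [Nat.add_sub_cancel_left]; ring
    rwa [h3] at h2
  · rw [map_mul, ← h, mul_assoc, ← map_mul, ← pow_add, Nat.add_sub_cancel' hm]

/-- Every `1`-cocycle of `I_Z(t)` is a coboundary of `𝒪(t)`. -/
theorem exists_eq_div_sub_div {k : Type*} [Field k] {J : Ideal (MvPolynomial (Fin 3) k)}
    {t : ℕ} {c : Fin 3 → Fin 3 → FractionRing (MvPolynomial (Fin 3) k)} (hc : c ∈ cocycles J t) :
    ∃ (n : ℕ) (N : Fin 3 → MvPolynomial (Fin 3) k), (∀ i, (N i).IsHomogeneous (t + n)) ∧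
      ∀ i j, c i j =
        algebraMap (MvPolynomial (Fin 3) k) (FractionRing (MvPolynomial (Fin 3) k)) (N j) /
          algebraMap (MvPolynomial (Fin 3) k) (FractionRing (MvPolynomial (Fin 3) k)) (X j) ^ n -
        algebraMap (MvPolynomial (Fin 3) k) (FractionRing (MvPolynomial (Fin 3) k)) (N i) /
          algebraMap (MvPolynomial (Fin 3) k) (FractionRing (MvPolynomial (Fin 3) k)) (X i) ^ n := by
  obtain ⟨hs, hcc⟩ := hc
  have hX : ∀ i : Fin 3, algebraMap (MvPolynomial (Fin 3) k)
      (FractionRing (MvPolynomial (Fin 3) k)) (X i) ≠ 0 := fun i => by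
    rw [Ne, IsFractionRing.to_map_eq_zero_iff]
    exact X_ne_zero i
  have hinj := IsFractionRing.injective (MvPolynomial (Fin 3) k)
    (FractionRing (MvPolynomial (Fin 3) k))
  obtain ⟨n₁, h₁⟩ := exists_numerator (hs 0 1)
  obtain ⟨n₂, h₂⟩ := exists_numerator (hs 1 2)
  obtain ⟨n₃, h₃⟩ := exists_numerator (hs 0 2)
  set n := n₁ + n₂ + n₃
  obtain ⟨G, -, hG, hGe⟩ := h₁ n (by omega)
  obtain ⟨G', -, hG', hGe'⟩ := h₂ n (by omega)
  obtain ⟨G'', -, hG'', hGe''⟩ := h₃ n (by omega)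
  rw [Finset.prod_pair (by decide), mul_pow, map_mul, map_pow, map_pow] at hGe hGe' hGe''
  rw [Finset.card_pair (by decide)] at hG hG' hG''
  have e1 : t + n * 2 = t + n + n := by ring
  rw [e1] at hG hG' hG''
  set φ := algebraMap (MvPolynomial (Fin 3) k) (FractionRing (MvPolynomial (Fin 3) k))
  have key : G * X 2 ^ n = (-G') * X 0 ^ n + G'' * X 1 ^ n := by
    apply hinj
    simp only [map_mul, map_add, map_neg, map_pow]
    change φ G * φ (X 2) ^ n = -φ G' * φ (X 0) ^ n + φ G'' * φ (X 1) ^ n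
    rw [← hGe, ← hGe', ← hGe'', ← hcc 0 1 2]
    ring
  obtain ⟨A, B, hA, hB, hAB⟩ :=
    exists_eq_mul_X_pow_add (a := 0) (b := 1) (c := 2) (by decide) (by decide) hG key
  have key2 : (G' + A * X 2 ^ n) * X 0 ^ n = (G'' - B * X 2 ^ n) * X 1 ^ n := by
    rw [hAB] at key
    linear_combination key
  have hcop : X 1 ^ n ∣ (G' + A * X 2 ^ n) := by
    have h1 : (X 1 ^ n : MvPolynomial (Fin 3) k) ∣ (G' + A * X 2 ^ n) * X 0 ^ n :=
      ⟨G'' - B * X 2 ^ n, by rw [key2]; ring⟩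
    refine (X_prime (i := (1 : Fin 3))).pow_dvd_of_dvd_mul_right n (fun h2 => ?_) h1
    have h3 := X_dvd_X.1 ((X_prime (i := (1 : Fin 3))).dvd_of_dvd_pow h2)
    exact absurd h3 (by decide)
  obtain ⟨C, hC⟩ := hcop
  have hCh : C.IsHomogeneous (t + n) := by
    have h1 : (G' + A * X 2 ^ n).IsHomogeneous (t + n + n) :=
      hG'.add (hA.mul (by simpa using (isHomogeneous_X k (2 : Fin 3)).pow n))
    have h2 := isHomogeneous_divMonomial 1 h1
    rwa [hC, X_pow_eq_monomial, divMonomial_monomial_mul] at h2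
  have hXn : ∀ i : Fin 3, φ (X i) ^ n ≠ 0 := fun i => pow_ne_zero _ (hX i)
  have e01 : c 0 1 = φ A / φ (X 1) ^ n - φ (-B) / φ (X 0) ^ n := by
    rw [hAB, map_add, map_mul, map_mul, map_pow, map_pow] at hGe
    rw [div_sub_div _ _ (hXn 1) (hXn 0), eq_div_iff (mul_ne_zero (hXn 1) (hXn 0)), map_neg]
    linear_combination hGe
  have e12 : c 1 2 = φ C / φ (X 2) ^ n - φ A / φ (X 1) ^ n := by
    have h1 := congrArg φ hC
    rw [map_add, map_mul, map_mul, map_pow, map_pow] at h1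
    rw [div_sub_div _ _ (hXn 2) (hXn 1), eq_div_iff (mul_ne_zero (hXn 2) (hXn 1))]
    linear_combination hGe' + h1
  have e02 := hcc 0 1 2
  have eii : ∀ i, c i i = 0 := fun i => by simpa using hcc i i i
  have eji : ∀ i j, c j i = - c i j := fun i j => by
    have := hcc i j i
    rw [eii] at this
    linear_combination this
  refine ⟨n, ![-B, A, C], fun i => ?_, fun i j => ?_⟩
  · fin_cases i
    · exact hB.neg
    · exact hA
    · exact hCh
  · fin_cases i <;> fin_cases j <;> simp [eii] <;>
      simp only [eji 0 1, eji 0 2, eji 1 2, ← e02, e01, e12, map_neg] <;> ring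

/-- If `Z` is described by conditions `G(F_v) ∈ I_v` in formal germs, and the forms of degree `t`
surject onto the product of the quotients `k⟦x, y⟧ / I_v`, then `h¹(ℙ², I_Z(t)) = 0`. -/
theorem h1_eq_zero {k : Type*} [Field k] {ι : Type*} {t : ℕ} [Finite ι]
    (F : ι → Fin 3 → MvPowerSeries (Fin 2) k) (I : ι → Ideal (MvPowerSeries (Fin 2) k))
    (J : Ideal (MvPolynomial (Fin 3) k)) (hF : ∀ v, ∃ i, IsUnit (F v i))
    (hI : ∀ v, ∃ n, IsLocalRing.maximalIdeal (MvPowerSeries (Fin 2) k) ^ n ≤ I v)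
    (hJ : ∀ (G : MvPolynomial (Fin 3) k) (d : ℕ), G.IsHomogeneous d →
      (∀ v, aeval (F v) G ∈ I v) → G ∈ J)
    (hJ' : ∀ G ∈ J, ∀ v, aeval (F v) G ∈ I v)
    (hsurj : ∀ g : ι → MvPowerSeries (Fin 2) k, ∃ H : MvPolynomial (Fin 3) k,
      H.IsHomogeneous t ∧ ∀ v, aeval (F v) H - g v ∈ I v) : h1 J t = 0 := by
  set φ := algebraMap (MvPolynomial (Fin 3) k) (FractionRing (MvPolynomial (Fin 3) k)) with hφ
  have hinj : Function.Injective φ := IsFractionRing.injective _ _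
  have hX : ∀ (i : Fin 3) (n : ℕ), φ (X i) ^ n ≠ 0 := fun i n => pow_ne_zero _ <| by
    rw [hφ, Ne, IsFractionRing.to_map_eq_zero_iff]
    exact X_ne_zero i
  suffices hsub : (coboundaries J t).submoduleOf (cocycles J t) = ⊤ by
    have : Subsingleton (H1 J t) := by
      exact Submodule.Quotient.subsingleton_iff.2 hsub
    exact rank_subsingleton' k (H1 J t)
  rw [Submodule.submoduleOf, Submodule.comap_subtype_eq_top]
  intro c hc
  obtain ⟨n, N, hN, hcN⟩ := exists_eq_div_sub_div hc
  -- the numerators agree modulo `I v` wherever two charts meet the germ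
  have hcompat : ∀ v i j, IsUnit (F v i) → IsUnit (F v j) →
      aeval (F v) (N j) * F v i ^ n - aeval (F v) (N i) * F v j ^ n ∈ I v := by
    intro v i j hi hj
    rcases eq_or_ne i j with rfl | hij
    · simp
    obtain ⟨m, G, hG, -, hGe⟩ := hc.1 i j
    rw [Finset.prod_pair hij, hcN] at hGe
    have h1 : (N j * X i ^ n - N i * X j ^ n) * (X i * X j) ^ m = G * (X i * X j) ^ n := by
      apply hinj
      rw [div_sub_div _ _ (hX j n) (hX i n), div_mul_eq_mul_div,
        div_eq_iff (mul_ne_zero (hX j n) (hX i n))] at hGe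
      simp only [map_mul, map_sub, map_pow] at hGe ⊢
      linear_combination hGe
    have h2 := congrArg (aeval (F v)) h1
    simp only [map_mul, map_sub, map_pow, aeval_X] at h2
    have h3 : IsUnit ((F v i * F v j) ^ m) := (hi.mul hj).pow m
    rw [← Ideal.mul_unit_mem_iff_mem _ h3, h2]
    exact Ideal.mul_mem_right _ _ (hJ' G hG v)
  choose i₀ hi₀ using hF
  choose w hw using fun v => (hi₀ v).pow n
  obtain ⟨H, hH, hHs⟩ := hsurj fun v => aeval (F v) (N (i₀ v)) * ((w v)⁻¹ : _ˣ)
  choose q hq using hI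
  obtain ⟨Q, hQ⟩ : ∃ Q, ∀ v, q v ≤ Q := by
    obtain ⟨Q, hQ⟩ := (Set.finite_range q).bddAbove
    exact ⟨Q, fun v => hQ ⟨v, rfl⟩⟩
  have hmem : ∀ j, (N j - H * X j ^ n) * X j ^ Q ∈ J := by
    intro j
    have hhom : ((N j - H * X j ^ n) * X j ^ Q).IsHomogeneous (t + n + Q) := by
      have hp : ∀ l, (X j ^ l : MvPolynomial (Fin 3) k).IsHomogeneous l := fun l => by
        simpa using (isHomogeneous_X k j).pow l
      exact ((hN j).sub (hH.mul (hp n))).mul (hp Q)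
    refine hJ _ _ hhom fun v => ?_
    simp only [map_mul, map_sub, map_pow, aeval_X]
    by_cases hj : IsUnit (F v j)
    · refine Ideal.mul_mem_right _ _ ?_
      have h1 := hcompat v (i₀ v) j (hi₀ v) hj
      have h2 := Ideal.mul_mem_right (F v j ^ n) _ (hHs v)
      have h3 := Ideal.mul_mem_right (((w v)⁻¹ : _ˣ) : MvPowerSeries (Fin 2) k) _ h1
      have h4 : F v (i₀ v) ^ n * (((w v)⁻¹ : _ˣ) : MvPowerSeries (Fin 2) k) = 1 := by
        rw [← hw]; simp
      have h5 := Ideal.sub_mem _ h3 h2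
      convert h5 using 1
      linear_combination (-aeval (F v) (N j)) * h4
    · refine Ideal.mul_mem_left _ _ (hq v (Ideal.pow_le_pow_right (hQ v) ?_))
      exact Ideal.pow_mem_pow hj Q
  refine ⟨fun i => φ (N i) / φ (X i) ^ n - φ H, fun i => ?_, fun i j => by rw [hcN]; ring⟩
  refine ⟨n + Q, _, hmem i, ?_, ?_⟩
  · have hp : ∀ l, (X i ^ l : MvPolynomial (Fin 3) k).IsHomogeneous l := fun l => by
      simpa using (isHomogeneous_X k i).pow l
    have := ((hN i).sub (hH.mul (hp n))).mul (hp Q)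
    simpa [add_assoc] using this
  · simp only [Finset.prod_singleton, map_mul, map_sub, map_pow, pow_add]
    rw [← hφ]
    field_simp [hX i n]

/-! ### Double points -/

/-- First order Taylor expansion modulo the square of an ideal. -/
theorem aeval_add_sub_mem_sq {k R : Type*} [Field k] [CommRing R] [Algebra k R] {σ : Type*}
    [Fintype σ] (𝔞 : Ideal R) (x δ : σ → R) (hδ : ∀ i, δ i ∈ 𝔞) (G : MvPolynomial σ k) :
    aeval (x + δ) G - aeval x G - ∑ i, δ i * aeval x (pderiv i G) ∈ 𝔞 ^ 2 := by
  classical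
  induction G using MvPolynomial.induction_on with
  | C a => simp
  | add p q hp hq =>
    have := Ideal.add_mem _ hp hq
    convert this using 1
    simp only [map_add, mul_add, Finset.sum_add_distrib]
    ring
  | mul_X p j hp =>
    have hd : ∀ i, aeval x (pderiv i (p * X j)) =
        aeval x (pderiv i p) * x j + if i = j then aeval x p else 0 := by
      intro i
      rw [Derivation.leibniz, pderiv_X]
      simp only [smul_eq_mul, map_add, map_mul, aeval_X]
      rcases eq_or_ne i j with rfl | h
      · simp; ring
      · simp [h.symm, h]; ring
    have hsum : ∑ i, δ i * aeval x (pderiv i (p * X j)) =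
        (∑ i, δ i * aeval x (pderiv i p)) * x j + δ j * aeval x p := by
      simp_rw [hd, mul_add, Finset.sum_add_distrib, Finset.sum_mul, mul_assoc]
      simp
    have h1 : (∑ i, δ i * aeval x (pderiv i p)) * δ j ∈ 𝔞 ^ 2 := by
      rw [sq]
      exact Ideal.mul_mem_mul (Ideal.sum_mem _ fun i _ => Ideal.mul_mem_right _ _ (hδ i)) (hδ j)
    have h2 := Ideal.add_mem _ (Ideal.mul_mem_right (x j + δ j) _ hp) h1
    convert h2 using 1
    rw [hsum]
    simp only [map_mul, aeval_X, Pi.add_apply]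
    ring

/-- The affine parametrization `(x, y) ↦ q + x e₁ + y e₂` of a neighbourhood of the point `[q]`,
where `q₀ ≠ 0`. -/
noncomputable def frame {k : Type*} [Field k] (q : Fin 3 → k) : Fin 3 → MvPowerSeries (Fin 2) k :=
  ![MvPowerSeries.C (q 0), MvPowerSeries.C (q 1) + MvPowerSeries.X 0,
    MvPowerSeries.C (q 2) + MvPowerSeries.X 1]

/-- The coefficients of `1`, `x` and `y` in the pullback of `G` along `frame q` are `G(q)`,
`∂₁G(q)` and `∂₂G(q)`. -/
theorem aeval_frame_mem_sq {k : Type*} [Field k] {q : Fin 3 → k} {G : MvPolynomial (Fin 3) k}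
    (hG : aeval (frame q) G ∈ IsLocalRing.maximalIdeal (MvPowerSeries (Fin 2) k) ^ 2) :
    eval q G = 0 ∧ eval q (pderiv 1 G) = 0 ∧ eval q (pderiv 2 G) = 0 := by
  have hx : ∀ P : MvPolynomial (Fin 3) k, aeval (fun i => MvPowerSeries.C (q i)) P =
      (MvPowerSeries.C (eval q P) : MvPowerSeries (Fin 2) k) := by
    intro P
    induction P using MvPolynomial.induction_on with
    | C a => simp [MvPowerSeries.algebraMap_apply]
    | add p q hp hq => simp [hp, hq]
    | mul_X p i hp => simp [hp]
  have h1 := aeval_add_sub_mem_sq (IsLocalRing.maximalIdeal (MvPowerSeries (Fin 2) k))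
    (fun i => MvPowerSeries.C (q i)) ![0, MvPowerSeries.X 0, MvPowerSeries.X 1] (fun i => by
      fin_cases i
      · exact Ideal.zero_mem _
      · exact X_mem_maximalIdeal 0
      · exact X_mem_maximalIdeal 1) G
  have h2 : (fun i => MvPowerSeries.C (q i)) + ![0, MvPowerSeries.X 0, MvPowerSeries.X 1] =
      frame q := by
    funext i
    fin_cases i <;> simp [frame]
  rw [h2] at h1
  have h3 := Ideal.sub_mem _ hG h1
  have h4 : aeval (frame q) G - (aeval (frame q) G - aeval (fun i => MvPowerSeries.C (q i)) G -
      ∑ i, (![0, MvPowerSeries.X 0, MvPowerSeries.X 1] : Fin 3 → MvPowerSeries (Fin 2) k) i *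
        aeval (fun i => MvPowerSeries.C (q i)) (pderiv i G)) =
      MvPowerSeries.C (eval q G) + MvPowerSeries.C (eval q (pderiv 1 G)) * MvPowerSeries.X 0 +
        MvPowerSeries.C (eval q (pderiv 2 G)) * MvPowerSeries.X 1 := by
    simp only [hx, Fin.sum_univ_three]
    simp
    ring
  rw [h4, mem_maximalIdeal_pow_iff] at h3
  have hne : (Finsupp.single (0 : Fin 2) 1 : Fin 2 →₀ ℕ) ≠ Finsupp.single 1 1 := by
    intro h
    have := DFunLike.congr_fun h 0
    simp at this
  refine ⟨?_, ?_, ?_⟩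
  · have := h3 0 (by simp)
    simpa [MvPowerSeries.coeff_C] using this
  · have := h3 (Finsupp.single 0 1) (by simp)
    simpa [MvPowerSeries.coeff_C, MvPowerSeries.coeff_X, hne] using this
  · have := h3 (Finsupp.single 1 1) (by simp)
    simpa [MvPowerSeries.coeff_C, MvPowerSeries.coeff_X, hne.symm] using this

/-- A form that vanishes at `q` vanishes identically on the line through `0` and `q`. -/
theorem aeval_C_mul_eq_zero {k : Type*} [Field k] {q : Fin 3 → k} {P : MvPolynomial (Fin 3) k}
    {d : ℕ} (hP : P.IsHomogeneous d) (h : eval q P = 0) (Y : MvPolynomial (Fin 3) k) :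
    aeval (fun i => C (q i) * Y) P = 0 := by
  have h1 : aeval (fun i => C (q i) * Y) P = C (eval q P) * Y ^ d := by
    rw [aeval_def, eval₂_eq', eval_eq', map_sum, Finset.sum_mul]
    refine Finset.sum_congr rfl fun m hm => ?_
    have h2 : ∑ i, m i = d := by
      have := hP (mem_support_iff.1 hm)
      simpa [Finsupp.weight_apply, Finsupp.sum_fintype] using this
    simp only [mul_pow, Finset.prod_mul_distrib, Finset.prod_pow_eq_pow_sum, h2, map_mul, map_prod,
      map_pow, algebraMap_eq]
    ring
  rw [h1, h, map_zero, zero_mul]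

/-- A form whose pullback along `frame q` is singular lies in the ideal of the double point. -/
theorem mem_fatPointIdeal_two {k : Type*} [Field k] {q : Fin 3 → k} (hq : q 0 ≠ 0)
    {G : MvPolynomial (Fin 3) k} {d : ℕ} (hGd : G.IsHomogeneous d)
    (hG : aeval (frame q) G ∈ IsLocalRing.maximalIdeal (MvPowerSeries (Fin 2) k) ^ 2) :
    G ∈ fatPointIdeal 2 q := by
  obtain ⟨h0, h1, h2⟩ := aeval_frame_mem_sq hG
  set Y : MvPolynomial (Fin 3) k := C (q 0)⁻¹ * X 0
  have hY : C (q 0) * Y = X 0 := by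
    rw [← mul_assoc, ← map_mul, mul_inv_cancel₀ hq, map_one, one_mul]
  have h3 := aeval_add_sub_mem_sq (pointIdeal q) (fun i => C (q i) * Y)
    (fun i => X i - C (q i) * Y) (fun i => Ideal.subset_span ⟨⟨1, ?_⟩, ?_⟩) G
  · have h4 : (fun i => C (q i) * Y) + (fun i => X i - C (q i) * Y) = X := by
      funext i; simp
    rw [h4, aeval_X_left_apply, Fin.sum_univ_three, aeval_C_mul_eq_zero hGd h0,
      aeval_C_mul_eq_zero hGd.pderiv h1, aeval_C_mul_eq_zero hGd.pderiv h2, hY] at h3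
    simpa [fatPointIdeal] using h3
  · refine (isHomogeneous_X k i).sub ?_
    have := (isHomogeneous_X k (0 : Fin 3)).C_mul (q i * (q 0)⁻¹)
    simpa [Y, mul_assoc] using this
  · simp [Y, hq]

theorem aeval_mem_maximalIdeal {k : Type*} [Field k] {q : Fin 3 → k} {G : MvPolynomial (Fin 3) k}
    (hG : eval q G = 0) :
    aeval (frame q) G ∈ IsLocalRing.maximalIdeal (MvPowerSeries (Fin 2) k) := by
  rw [IsLocalRing.mem_maximalIdeal, mem_nonunits_iff, MvPowerSeries.isUnit_iff_constantCoeff]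
  have h : ∀ P : MvPolynomial (Fin 3) k,
      MvPowerSeries.constantCoeff (aeval (frame q) P) = eval q P := by
    intro P
    induction P using MvPolynomial.induction_on with
    | C a => simp [MvPowerSeries.algebraMap_apply]
    | add p q hp hq => simp [hp, hq]
    | mul_X p i hp =>
      rw [map_mul, map_mul, hp, map_mul, aeval_X, eval_X]
      congr 1
      fin_cases i <;> simp [frame]
  rw [h, hG]
  simp

theorem aeval_frame_mem_of_mem_fatPointIdeal {k : Type*} [Field k] {q : Fin 3 → k} {n : ℕ}
    {G : MvPolynomial (Fin 3) k} (hG : G ∈ fatPointIdeal n q) :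
    aeval (frame q) G ∈ IsLocalRing.maximalIdeal (MvPowerSeries (Fin 2) k) ^ n := by
  have h : pointIdeal q ≤ (IsLocalRing.maximalIdeal (MvPowerSeries (Fin 2) k)).comap
      (aeval (frame q)) := by
    refine Ideal.span_le.2 ?_
    rintro P ⟨-, hP⟩
    exact aeval_mem_maximalIdeal hP
  exact Ideal.le_comap_pow _ n (Ideal.pow_right_mono h n hG)

theorem aeval_mem_of_mem_imageIdeal {k : Type*} [Field k] {F : Fin 3 → MvPowerSeries (Fin 2) k}
    {I : Ideal (MvPowerSeries (Fin 2) k)} {G : MvPolynomial (Fin 3) k}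
    (hG : G ∈ imageIdeal F I) : aeval F G ∈ I := by
  have h : imageIdeal F I ≤ I.comap (aeval F) := by
    refine Ideal.span_le.2 ?_
    rintro P ⟨-, hP⟩
    exact hP
  exact h hG

end Cech

/-! ### Jets -/

/-- The exponents `(a, b)` with `a + b < n`. -/
def triangle (n : ℕ) : Finset (ℕ × ℕ) :=
  (Finset.range n ×ˢ Finset.range n).filter fun p => p.1 + p.2 < n

theorem mem_triangle {n : ℕ} {p : ℕ × ℕ} : p ∈ triangle n ↔ p.1 + p.2 < n := by
  simp only [triangle, Finset.mem_filter, Finset.mem_product, Finset.mem_range]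
  omega

/-- The pair `(a, b)` as the exponent of `x ^ a * y ^ b`. -/
noncomputable def expo (p : ℕ × ℕ) : Fin 2 →₀ ℕ := Finsupp.single 0 p.1 + Finsupp.single 1 p.2

@[simp] theorem expo_zero (p : ℕ × ℕ) : expo p 0 = p.1 := by simp [expo]

@[simp] theorem expo_one (p : ℕ × ℕ) : expo p 1 = p.2 := by simp [expo]

theorem expo_eq (d : Fin 2 →₀ ℕ) : expo (d 0, d 1) = d := by
  ext i; fin_cases i <;> simp

theorem expo_injective : Function.Injective expo := fun p q h => by
  have h0 := DFunLike.congr_fun h 0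
  have h1 := DFunLike.congr_fun h 1
  simp only [expo_zero, expo_one] at h0 h1
  exact Prod.ext h0 h1

theorem degree_expo (p : ℕ × ℕ) : (expo p).degree = p.1 + p.2 := by
  simp [expo]

theorem mem_maximalIdeal_pow_iff_triangle {k : Type*} [Field k] {n : ℕ}
    {g : MvPowerSeries (Fin 2) k} :
    g ∈ IsLocalRing.maximalIdeal (MvPowerSeries (Fin 2) k) ^ n ↔
      ∀ p ∈ triangle n, MvPowerSeries.coeff (expo p) g = 0 := by
  rw [mem_maximalIdeal_pow_iff]
  refine ⟨fun h p hp => h _ ?_, fun h d hd => ?_⟩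
  · rw [degree_expo]; exact mem_triangle.1 hp
  · rw [← expo_eq d] at hd ⊢
    rw [degree_expo] at hd
    exact h _ (mem_triangle.2 hd)

theorem sub_sum_monomial_mem {k : Type*} [Field k] (n : ℕ) (g : MvPowerSeries (Fin 2) k) :
    g - ∑ p ∈ triangle n, MvPowerSeries.coeff (expo p) g • MvPowerSeries.monomial (expo p) (1 : k) ∈
      IsLocalRing.maximalIdeal (MvPowerSeries (Fin 2) k) ^ n := by
  rw [mem_maximalIdeal_pow_iff_triangle]
  intro q hq
  rw [map_sub, map_sum, Finset.sum_eq_single q]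
  · simp
  · intro p _ hpq
    rw [map_smul, MvPowerSeries.coeff_monomial, if_neg (fun h => hpq (expo_injective h).symm),
      smul_zero]
  · exact fun h => absurd hq h

theorem finite_quotient_of_maximalIdeal_pow_le {k : Type*} [Field k] {n : ℕ}
    {I : Ideal (MvPowerSeries (Fin 2) k)}
    (hI : IsLocalRing.maximalIdeal (MvPowerSeries (Fin 2) k) ^ n ≤ I) :
    Module.Finite k (MvPowerSeries (Fin 2) k ⧸ I) ∧
      Module.finrank k (MvPowerSeries (Fin 2) k ⧸ I) ≤ (triangle n).card := by
  classical
  set S : Finset (MvPowerSeries (Fin 2) k ⧸ I) :=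
    (triangle n).image fun p => Ideal.Quotient.mk I (MvPowerSeries.monomial (expo p) (1 : k))
  have hS : Submodule.span k (S : Set (MvPowerSeries (Fin 2) k ⧸ I)) = ⊤ := by
    rw [eq_top_iff]
    rintro x -
    obtain ⟨g, rfl⟩ := Ideal.Quotient.mk_surjective x
    have h1 := Ideal.Quotient.eq.2 (hI (sub_sum_monomial_mem n g))
    rw [h1, map_sum]
    refine Submodule.sum_mem _ fun p hp => ?_
    have h2 : Ideal.Quotient.mk I (MvPowerSeries.coeff (expo p) g •
        MvPowerSeries.monomial (expo p) (1 : k)) = MvPowerSeries.coeff (expo p) g •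
          Ideal.Quotient.mk I (MvPowerSeries.monomial (expo p) (1 : k)) := rfl
    rw [h2]
    exact Submodule.smul_mem _ _ (Submodule.subset_span (Finset.mem_coe.2
      (Finset.mem_image_of_mem _ hp)))
  refine ⟨⟨⟨S, hS⟩⟩, ?_⟩
  rw [← finrank_top k, ← hS]
  exact (finrank_span_finset_le_card S).trans Finset.card_image_le

/-! ### Openness of the surjectivity -/

/-- The germs of a configuration: the affine parametrizations at its points, and its formal
isomorphisms. -/
noncomputable def Configuration.germ {k : Type*} [Field k] {e r : ℕ} (c : Configuration k e r) :
    Fin e ⊕ Fin r → Fin 3 → MvPowerSeries (Fin 2) k :=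
  Sum.elim (fun j => frame (c.point j)) c.iso

/-- The ideals of a union in the germs of a configuration: `(x, y)²` for the double points, and
the given ideals. -/
noncomputable def localIdeal {k : Type*} [Field k] (e : ℕ) {r : ℕ}
    (Z : Fin r → Ideal (MvPowerSeries (Fin 2) k)) :
    Fin e ⊕ Fin r → Ideal (MvPowerSeries (Fin 2) k) :=
  Sum.elim (fun _ => IsLocalRing.maximalIdeal (MvPowerSeries (Fin 2) k) ^ 2) Z

/-- The coefficients of the pullback of a fixed form to the germs of a configuration are polynomials
in the parameters of the configuration, because they are so for the universal configuration. -/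
theorem exists_polynomial_coeff_aeval_germ {k : Type*} [Field k] {e r : ℕ} (v : Fin e ⊕ Fin r)
    (G : MvPolynomial (Fin 3) k) (d : Fin 2 →₀ ℕ) :
    ∃ Ψ : MvPolynomial ((Fin e × Fin 3) ⊕ (Fin r × Fin 3 × (Fin 2 →₀ ℕ))) k,
      ∀ c : Configuration k e r, MvPolynomial.eval c.coord Ψ =
        MvPowerSeries.coeff d (MvPolynomial.aeval (c.germ v) G) := by
  obtain ⟨𝔽, h𝔽⟩ : ∃ 𝔽 : Fin 3 → MvPowerSeries (Fin 2)
      (MvPolynomial ((Fin e × Fin 3) ⊕ (Fin r × Fin 3 × (Fin 2 →₀ ℕ))) k),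
      ∀ (c : Configuration k e r) (a : Fin 3),
        MvPowerSeries.map (MvPolynomial.eval c.coord) (𝔽 a) = c.germ v a := by
    rcases v with j | i
    · refine ⟨![MvPowerSeries.C (MvPolynomial.X (Sum.inl (j, 0))),
        MvPowerSeries.C (MvPolynomial.X (Sum.inl (j, 1))) + MvPowerSeries.X 0,
        MvPowerSeries.C (MvPolynomial.X (Sum.inl (j, 2))) + MvPowerSeries.X 1], fun c a => ?_⟩
      fin_cases a <;> simp [Configuration.germ, frame, Configuration.coord]
    · refine ⟨fun a d => MvPolynomial.X (Sum.inr (i, a, d)), fun c a => ?_⟩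
      ext d
      change MvPolynomial.eval c.coord (MvPolynomial.X (Sum.inr (i, a, d))) = _
      rw [MvPolynomial.eval_X]
      rfl
  refine ⟨MvPowerSeries.coeff d (MvPolynomial.aeval 𝔽 G), fun c => ?_⟩
  rw [← MvPowerSeries.coeff_map]
  congr 1
  induction G using MvPolynomial.induction_on with
  | C a => simp [MvPowerSeries.algebraMap_apply]
  | add p q hp hq => simp only [map_add, hp, hq]
  | mul_X p i hp => simp only [map_mul, hp, MvPolynomial.aeval_X, h𝔽]

/-- If the forms of degree `t` surject onto the product of the local rings of one union, at points
outside `X₀ = 0`, then they do so for a general union, and there `h¹` vanishes. -/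
theorem forGeneral_of_exists {k : Type*} [Field k] {t e r : ℕ}
    {Z : Fin r → Ideal (MvPowerSeries (Fin 2) k)}
    (hZ : ∀ i, ∃ n, IsLocalRing.maximalIdeal (MvPowerSeries (Fin 2) k) ^ n ≤ Z i)
    (c₀ : Configuration k e r) (hc₀ : ∀ j, c₀.point j 0 ≠ 0)
    (hs : ∀ g : Fin e ⊕ Fin r → MvPowerSeries (Fin 2) k, ∃ H : MvPolynomial (Fin 3) k,
      H.IsHomogeneous t ∧ ∀ v, MvPolynomial.aeval (c₀.germ v) H - g v ∈ localIdeal e Z v) :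
    ForGeneral fun c : Configuration k e r => h1 (c.unionIdeal Z) t = 0 := by
  classical
  have hI : ∀ v, ∃ n, IsLocalRing.maximalIdeal (MvPowerSeries (Fin 2) k) ^ n ≤
      localIdeal e Z v := by
    rintro (j | i)
    · exact ⟨2, le_rfl⟩
    · exact hZ i
  choose q hq using hI
  obtain ⟨Q, hQ⟩ : ∃ Q, ∀ v, q v ≤ Q := by
    obtain ⟨Q, hQ⟩ := (Set.finite_range q).bddAbove
    exact ⟨Q, fun v => hQ ⟨v, rfl⟩⟩
  have hIQ : ∀ v, IsLocalRing.maximalIdeal (MvPowerSeries (Fin 2) k) ^ Q ≤ localIdeal e Z v :=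
    fun v => (Ideal.pow_le_pow_right (hQ v)).trans (hq v)
  have hfin : ∀ v, Module.Finite k (MvPowerSeries (Fin 2) k ⧸ localIdeal e Z v) := fun v =>
    (finite_quotient_of_maximalIdeal_pow_le (hIQ v)).1
  set U := ∀ v, MvPowerSeries (Fin 2) k ⧸ localIdeal e Z v with hU
  let B := Module.finBasis k U
  let π : (Fin e ⊕ Fin r → MvPowerSeries (Fin 2) k) →ₗ[k] U :=
    LinearMap.pi fun v => (Ideal.Quotient.mkₐ k (localIdeal e Z v)).toLinearMap ∘ₗ LinearMap.proj v
  have hπ : ∀ g v, π g v = Ideal.Quotient.mk _ (g v) := fun _ _ => rfl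
  have hπ0 : ∀ g, (∀ v, g v ∈ localIdeal e Z v) → π g = 0 := fun g hg => by
    funext v
    rw [hπ]
    exact Ideal.Quotient.eq_zero_iff_mem.2 (hg v)
  -- coordinates of `π g` are linear combinations of the coefficients of `g` of degree `< Q`
  have hcoord : ∀ (a : Fin (Module.finrank k U)) (g : Fin e ⊕ Fin r → MvPowerSeries (Fin 2) k),
      B.repr (π g) a = ∑ v, ∑ p ∈ triangle Q, MvPowerSeries.coeff (expo p) (g v) *
        B.repr (π (Pi.single v (MvPowerSeries.monomial (expo p) (1 : k)))) a := by
    intro a g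
    have h1 : π g = π (∑ v, ∑ p ∈ triangle Q, MvPowerSeries.coeff (expo p) (g v) •
        Pi.single v (MvPowerSeries.monomial (expo p) (1 : k))) := by
      rw [← sub_eq_zero, ← map_sub]
      refine hπ0 _ fun v => hIQ v ?_
      convert sub_sum_monomial_mem Q (g v) using 1
      rw [Pi.sub_apply, Finset.sum_apply, Finset.sum_eq_single v]
      · simp
      · intro w _ hw
        rw [Finset.sum_apply]
        exact Finset.sum_eq_zero fun p _ => by simp [hw.symm]
      · simp
    rw [h1]
    simp only [map_sum, map_smul, Finsupp.coe_finsetSum, Finset.sum_apply, Finsupp.smul_apply,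
      smul_eq_mul]
  choose lift hlift using fun a => fun v => Ideal.Quotient.mk_surjective (I := localIdeal e Z v)
    (B a v)
  choose H hH hHs using fun a => hs (lift a)
  choose Ψ hΨ using fun (v : Fin e ⊕ Fin r) (G : MvPolynomial (Fin 3) k) (d : Fin 2 →₀ ℕ) =>
    exists_polynomial_coeff_aeval_germ (e := e) (r := r) v G d
  let M : Matrix (Fin (Module.finrank k U)) (Fin (Module.finrank k U))
      (MvPolynomial ((Fin e × Fin 3) ⊕ (Fin r × Fin 3 × (Fin 2 →₀ ℕ))) k) := fun a b =>
    ∑ v, ∑ p ∈ triangle Q, Ψ v (H b) (expo p) *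
      MvPolynomial.C (B.repr (π (Pi.single v (MvPowerSeries.monomial (expo p) (1 : k)))) a)
  have hM : ∀ (c : Configuration k e r) a b, MvPolynomial.eval c.coord (M a b) =
      B.repr (π fun v => MvPolynomial.aeval (c.germ v) (H b)) a := by
    intro c a b
    rw [hcoord]
    simp only [M, map_sum, map_mul, hΨ, MvPolynomial.eval_C]
  have hdet : ∀ c : Configuration k e r, MvPolynomial.eval c.coord M.det =
      (M.map (MvPolynomial.eval c.coord)).det := fun c => by
    rw [RingHom.map_det]; rfl
  refine ⟨M.det * ∏ j, MvPolynomial.X (Sum.inl (j, 0)), ⟨c₀, ?_⟩, fun c hc => ?_⟩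
  · rw [map_mul, hdet, map_prod]
    refine mul_ne_zero ?_ (Finset.prod_ne_zero_iff.2 fun j _ => by
      rw [MvPolynomial.eval_X]; exact hc₀ j)
    have h1 : M.map (MvPolynomial.eval c₀.coord) = 1 := by
      ext a b
      rw [Matrix.map_apply, hM]
      have h2 : (π fun v => MvPolynomial.aeval (c₀.germ v) (H b)) = B b := by
        funext v
        rw [hπ, ← hlift]
        exact Ideal.Quotient.eq.2 (hHs b v)
      rw [h2, B.repr_self, Matrix.one_apply, Finsupp.single_apply]
      simp only [eq_comm]
    rw [h1, Matrix.det_one]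
    exact one_ne_zero
  · rw [map_mul, hdet, map_prod] at hc
    have hc0 : ∀ j, c.point j 0 ≠ 0 := fun j => by
      have := Finset.prod_ne_zero_iff.1 (right_ne_zero_of_mul hc) j (Finset.mem_univ _)
      rw [MvPolynomial.eval_X] at this
      exact this
    have hunit : IsUnit (M.map (MvPolynomial.eval c.coord)).det :=
      (left_ne_zero_of_mul hc).isUnit
    refine h1_eq_zero c.germ (localIdeal e Z) _ ?_ (fun v => ⟨Q, hIQ v⟩) ?_ ?_ ?_
    · rintro (j | i)
      · refine ⟨0, ?_⟩
        rw [MvPowerSeries.isUnit_iff_constantCoeff]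
        simpa [Configuration.germ, frame] using hc0 j
      · have h1 := (c.isFormalIso i).ne_zero 0
        obtain ⟨a, ha⟩ := Function.ne_iff.1 h1
        refine ⟨a, ?_⟩
        rw [MvPowerSeries.isUnit_iff_constantCoeff]
        exact IsUnit.mk0 _ ha
    · intro G d hG hGv
      refine Submodule.mem_inf.2 ⟨Submodule.mem_iInf _ |>.2 fun j => ?_,
        Submodule.mem_iInf _ |>.2 fun i => Ideal.subset_span ⟨⟨d, hG⟩, hGv (Sum.inr i)⟩⟩
      exact mem_fatPointIdeal_two (hc0 j) hG (hGv (Sum.inl j))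
    · intro G hG v
      obtain ⟨hG1, hG2⟩ := Submodule.mem_inf.1 hG
      rcases v with j | i
      · exact aeval_frame_mem_of_mem_fatPointIdeal ((Submodule.mem_iInf _).1 hG1 j)
      · exact aeval_mem_of_mem_imageIdeal ((Submodule.mem_iInf _).1 hG2 i)
    · intro g
      set x := (M.map (MvPolynomial.eval c.coord))⁻¹.mulVec (B.repr (π g)) with hx
      have hMx : (M.map (MvPolynomial.eval c.coord)).mulVec x = B.repr (π g) := by
        rw [hx, Matrix.mulVec_mulVec, Matrix.mul_nonsing_inv _ hunit, Matrix.one_mulVec]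
      refine ⟨∑ b, x b • H b, ?_, fun v => ?_⟩
      · refine MvPolynomial.IsHomogeneous.sum _ _ _ fun b _ => ?_
        exact (MvPolynomial.homogeneousSubmodule (Fin 3) k _).smul_mem _ (hH b)
      · have h1 : (π fun v => MvPolynomial.aeval (c.germ v) (∑ b, x b • H b)) = π g := by
          apply B.repr.injective
          ext a
          rw [← hMx, Matrix.mulVec, dotProduct]
          have h2 : (fun v => MvPolynomial.aeval (c.germ v) (∑ b, x b • H b)) =
              ∑ b, x b • fun v => MvPolynomial.aeval (c.germ v) (H b) := by
            funext v
            simp only [map_sum, map_smul, Finset.sum_apply, Pi.smul_apply]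
          rw [h2]
          simp only [map_sum, map_smul, Finsupp.coe_finsetSum, Finset.sum_apply,
            Finsupp.smul_apply, smul_eq_mul, Matrix.map_apply, hM]
          exact Finset.sum_congr rfl fun b _ => mul_comm _ _
        exact Ideal.Quotient.eq.1 (congrFun h1 v)

/-! ### Planar polynomials and their expansions at points -/

/-- The Taylor expansion at `P` of the polynomial with coefficients `f`, where `f (a, b)` is the
coefficient of `x ^ a * y ^ b`. -/
noncomputable def translate {k : Type*} [Field k] (P : k × k) :
    (ℕ × ℕ →₀ k) →ₗ[k] MvPowerSeries (Fin 2) k :=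
  Finsupp.linearCombination k fun q =>
    (MvPowerSeries.X 0 + MvPowerSeries.C P.1) ^ q.1 *
      (MvPowerSeries.X 1 + MvPowerSeries.C P.2) ^ q.2

/-- The Taylor coefficient with exponent `d` at `P` of the monomial with exponent `q`. -/
def jet {k : Type*} [Field k] (P : k × k) (d q : ℕ × ℕ) : k :=
  q.1.choose d.1 * q.2.choose d.2 * P.1 ^ (q.1 - d.1) * P.2 ^ (q.2 - d.2)

theorem coeff_expo_mul_pow {k : Type*} [Field k] (P : k × k) (d q : ℕ × ℕ) :
    MvPowerSeries.coeff (expo d) ((MvPowerSeries.X 0 + MvPowerSeries.C P.1) ^ q.1 *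
      (MvPowerSeries.X 1 + MvPowerSeries.C P.2) ^ q.2 : MvPowerSeries (Fin 2) k) = jet P d q := by
  have h1 : ((MvPowerSeries.X 0 + MvPowerSeries.C P.1) ^ q.1 *
      (MvPowerSeries.X 1 + MvPowerSeries.C P.2) ^ q.2 : MvPowerSeries (Fin 2) k) =
      ∑ p ∈ Finset.range (q.1 + 1) ×ˢ Finset.range (q.2 + 1),
        MvPowerSeries.monomial (expo p) (jet P p q) := by
    rw [add_pow, add_pow, Finset.sum_mul_sum, Finset.sum_product]
    refine Finset.sum_congr rfl fun i _ => Finset.sum_congr rfl fun j _ => ?_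
    have h2 : (MvPowerSeries.monomial (expo (i, j)) (jet P (i, j) q) : MvPowerSeries (Fin 2) k) =
        MvPowerSeries.X 0 ^ i * MvPowerSeries.X 1 ^ j * MvPowerSeries.C (jet P (i, j) q) := by
      rw [MvPowerSeries.X_pow_eq, MvPowerSeries.X_pow_eq, ← MvPowerSeries.monomial_zero_eq_C_apply,
        MvPowerSeries.monomial_mul_monomial, MvPowerSeries.monomial_mul_monomial]
      simp [expo]
    rw [h2, jet]
    simp only [map_mul, map_pow, map_natCast]
    ring
  rw [h1, map_sum]
  simp only [MvPowerSeries.coeff_monomial, expo_injective.eq_iff]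
  rw [Finset.sum_ite_eq]
  split_ifs with h
  · rfl
  · simp only [Finset.mem_product, Finset.mem_range, not_and_or, not_lt] at h
    rcases h with h | h
    · simp [jet, Nat.choose_eq_zero_of_lt (show q.1 < d.1 by omega)]
    · simp [jet, Nat.choose_eq_zero_of_lt (show q.2 < d.2 by omega)]

theorem coeff_translate {k : Type*} [Field k] (P : k × k) (d : ℕ × ℕ) (f : ℕ × ℕ →₀ k) :
    MvPowerSeries.coeff (expo d) (translate P f) = f.sum fun q c => c * jet P d q := by
  rw [translate, Finsupp.linearCombination_apply, Finsupp.sum, map_sum, Finsupp.sum]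
  refine Finset.sum_congr rfl fun q _ => ?_
  rw [map_smul, coeff_expo_mul_pow, smul_eq_mul]

theorem coeff_translate_of_mem {k : Type*} [Field k] (P : k × k) (d : ℕ × ℕ) {f : ℕ × ℕ →₀ k}
    {S : Finset (ℕ × ℕ)} (hf : f ∈ Finsupp.supported k k (S : Set (ℕ × ℕ))) :
    MvPowerSeries.coeff (expo d) (translate P f) = ∑ q ∈ S, f q * jet P d q := by
  rw [coeff_translate]
  exact Finsupp.sum_of_support_subset _ (Finset.coe_subset.1 ((Finsupp.mem_supported k f).1 hf))
    (fun q c => c * jet P d q) fun _ _ => zero_mul _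

/-- The polynomials in `V` surject onto the product of the quotients by `I i` of the local rings at
the points `P i`. -/
def Imposes {k : Type*} [Field k] {ι : Type*} (V : Submodule k (ℕ × ℕ →₀ k)) (P : ι → k × k)
    (I : ι → Ideal (MvPowerSeries (Fin 2) k)) : Prop :=
  ∀ g : ι → MvPowerSeries (Fin 2) k, ∃ f ∈ V, ∀ i, translate (P i) f - g i ∈ I i

theorem Imposes.mono {k : Type*} [Field k] {ι : Type*} {V : Submodule k (ℕ × ℕ →₀ k)}
    {P : ι → k × k} {I I' : ι → Ideal (MvPowerSeries (Fin 2) k)} (h : Imposes V P I)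
    (hI : ∀ i, I i ≤ I' i) : Imposes V P I' := fun g => by
  obtain ⟨f, hf, hfg⟩ := h g
  exact ⟨f, hf, fun i => hI i (hfg i)⟩

theorem imposes_maximalIdeal_pow_iff {k : Type*} [Field k] {ι : Type*}
    {V : Submodule k (ℕ × ℕ →₀ k)} {P : ι → k × k} {n : ι → ℕ} :
    Imposes V P (fun i => IsLocalRing.maximalIdeal (MvPowerSeries (Fin 2) k) ^ n i) ↔
      ∀ g : ι → ℕ × ℕ → k, ∃ f ∈ V, ∀ i, ∀ d ∈ triangle (n i),
        MvPowerSeries.coeff (expo d) (translate (P i) f) = g i d := by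
  refine ⟨fun h g => ?_, fun h g => ?_⟩
  · obtain ⟨G, hG⟩ : ∃ G : ι → MvPowerSeries (Fin 2) k,
        ∀ i d, MvPowerSeries.coeff (expo d) (G i) = g i d := by
      refine ⟨fun i d => g i (d 0, d 1), fun i d => ?_⟩
      change g i (expo d 0, expo d 1) = _
      rw [expo_zero, expo_one]
    obtain ⟨f, hf, hfg⟩ := h G
    refine ⟨f, hf, fun i d hd => ?_⟩
    have h1 := mem_maximalIdeal_pow_iff_triangle.1 (hfg i) d hd
    rw [map_sub, sub_eq_zero] at h1
    rw [h1, hG]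
  · obtain ⟨f, hf, hfg⟩ := h fun i d => MvPowerSeries.coeff (expo d) (g i)
    refine ⟨f, hf, fun i => mem_maximalIdeal_pow_iff_triangle.2 fun d hd => ?_⟩
    rw [map_sub, hfg i d hd, sub_self]

/-! ### Initial exponents -/

/-- The weight of the exponent `(a, b)`. It is injective on the exponents of total degree at most
`t`, and orders them first by total degree. -/
def weight (t : ℕ) (p : ℕ × ℕ) : ℕ := (t + 1) * p.1 + (t + 2) * p.2

theorem weight_eq (t : ℕ) (p : ℕ × ℕ) : weight t p = (t + 1) * (p.1 + p.2) + p.2 := by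
  rw [weight]; ring

theorem add_le_of_weight_le {t : ℕ} {p q : ℕ × ℕ} (hq : q ∈ triangle (t + 1))
    (h : weight t p ≤ weight t q) : p.1 + p.2 ≤ q.1 + q.2 := by
  rw [mem_triangle] at hq
  rw [weight_eq, weight_eq] at h
  by_contra! hlt
  have h1 : (t + 1) * (q.1 + q.2 + 1) ≤ (t + 1) * (p.1 + p.2) := Nat.mul_le_mul_left _ hlt
  rw [mul_add, mul_one] at h1
  omega

theorem weight_injOn {t : ℕ} {p q : ℕ × ℕ} (hp : p ∈ triangle (t + 1)) (hq : q ∈ triangle (t + 1))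
    (h : weight t p = weight t q) : p = q := by
  have h1 := le_antisymm (add_le_of_weight_le hq h.le) (add_le_of_weight_le hp h.ge)
  rw [weight_eq, weight_eq, h1] at h
  ext <;> omega

open Classical in
/-- The exponents of least weight of the polynomials in `V`. -/
noncomputable def initials {k : Type*} [Field k] (t : ℕ) (V : Submodule k (ℕ × ℕ →₀ k)) :
    Finset (ℕ × ℕ) :=
  (triangle (t + 1)).filter fun p =>
    ∃ f ∈ V, f p = 1 ∧ ∀ q, weight t q < weight t p → f q = 0

theorem mem_initials {k : Type*} [Field k] {t : ℕ} {V : Submodule k (ℕ × ℕ →₀ k)} {p : ℕ × ℕ} :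
    p ∈ initials t V ↔ p ∈ triangle (t + 1) ∧
      ∃ f ∈ V, f p = 1 ∧ ∀ q, weight t q < weight t p → f q = 0 := by
  simp only [initials, Finset.mem_filter]

theorem initials_mono {k : Type*} [Field k] {t : ℕ} {V W : Submodule k (ℕ × ℕ →₀ k)} (h : V ≤ W) :
    initials t V ⊆ initials t W := by
  intro p hp
  rw [mem_initials] at hp ⊢
  obtain ⟨hp, f, hf, hfp⟩ := hp
  exact ⟨hp, f, h hf, hfp⟩

/-- No nonzero element of `V` vanishes at all initial exponents. -/
theorem finrank_le_card_initials {k : Type*} [Field k] {t : ℕ} {V : Submodule k (ℕ × ℕ →₀ k)}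
    (hV : V ≤ Finsupp.supported k k (triangle (t + 1) : Set (ℕ × ℕ))) :
    Module.finrank k V ≤ (initials t V).card := by
  let φ : V →ₗ[k] ({p // p ∈ initials t V} → k) :=
    LinearMap.pi fun p => Finsupp.lapply (p : ℕ × ℕ) ∘ₗ V.subtype
  have hφ : Function.Injective φ := by
    suffices hker : ∀ f : V, φ f = 0 → f = 0 from fun f g hfg =>
      sub_eq_zero.1 (hker _ (by rw [map_sub, hfg, sub_self]))
    rintro ⟨f, hf⟩ h0
    by_contra hne
    have hne' : f.support.Nonempty := by
      rw [Finsupp.support_nonempty_iff]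
      exact fun h => hne (by ext1; exact h)
    obtain ⟨p, hp, hpmin⟩ := Finset.exists_min_image f.support (weight t) hne'
    rw [Finsupp.mem_support_iff] at hp
    have hpA : p ∈ initials t V := by
      rw [mem_initials]
      refine ⟨?_, (f p)⁻¹ • f, V.smul_mem _ hf, ?_, fun q hq => ?_⟩
      · exact (Finsupp.mem_supported k f).1 (hV hf)
          (Finset.mem_coe.2 (Finsupp.mem_support_iff.2 hp))
      · simp [hp]
      · have : f q = 0 := by
          by_contra h
          exact absurd (hpmin q (Finsupp.mem_support_iff.2 h)) (not_le.2 hq)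
        simp [this]
    exact hp (congrFun h0 ⟨p, hpA⟩)
  simpa using LinearMap.finrank_le_finrank_of_injective hφ

/-- Taylor coefficients are homogeneous for the action of the torus. -/
theorem pow_weight_mul_jet {k : Type*} [Field k] (t : ℕ) (s : k) (P : k × k) (d q : ℕ × ℕ) :
    s ^ weight t d * jet (s ^ (t + 1) * P.1, s ^ (t + 2) * P.2) d q =
      s ^ weight t q * jet P d q := by
  rcases lt_or_ge q.1 d.1 with h | h
  · simp [jet, Nat.choose_eq_zero_of_lt h]
  rcases lt_or_ge q.2 d.2 with h' | h'
  · simp [jet, Nat.choose_eq_zero_of_lt h']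
  obtain ⟨a, ha⟩ := Nat.exists_eq_add_of_le h
  obtain ⟨b, hb⟩ := Nat.exists_eq_add_of_le h'
  simp only [jet, weight, ha, hb, Nat.add_sub_cancel_left]
  rw [mul_pow, mul_pow, ← pow_mul, ← pow_mul]
  ring

/-- Semicontinuity under the torus degeneration `(x, y) ↦ (s ^ (t + 1) x, s ^ (t + 2) y)`, `s → 0`,
of `V` to the space spanned by its initial monomials: conditions imposed by fat points on the
limit are imposed on `V` for some `s ≠ 0`. -/
theorem Imposes.of_initials {k : Type*} [Field k] [Infinite k] {t : ℕ}
    {V : Submodule k (ℕ × ℕ →₀ k)}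
    (hV : V ≤ Finsupp.supported k k (triangle (t + 1) : Set (ℕ × ℕ))) {ι : Type*} [Finite ι]
    {Q : ι → k × k} {n : ι → ℕ}
    (h : Imposes (Finsupp.supported k k (initials t V : Set (ℕ × ℕ))) Q
      fun i => IsLocalRing.maximalIdeal (MvPowerSeries (Fin 2) k) ^ n i) :
    ∃ s : k, s ≠ 0 ∧ Imposes V (fun i => (s ^ (t + 1) * (Q i).1, s ^ (t + 2) * (Q i).2))
      fun i => IsLocalRing.maximalIdeal (MvPowerSeries (Fin 2) k) ^ n i := by
  classical
  have := Fintype.ofFinite ι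
  rw [imposes_maximalIdeal_pow_iff] at h
  have hF : ∀ p : initials t V, ∃ f ∈ V, f p = 1 ∧ ∀ q, weight t q < weight t p → f q = 0 :=
    fun p => (mem_initials.1 p.2).2
  choose F hFV hF1 hF0 using hF
  let κ := Σ i : ι, triangle (n i)
  have hσ : ∀ b : κ, ∃ f ∈ Finsupp.supported k k (initials t V : Set (ℕ × ℕ)), ∀ a : κ,
      MvPowerSeries.coeff (expo a.2) (translate (Q a.1) f) = if a = b then 1 else 0 := by
    rintro ⟨j, d', hd'⟩
    obtain ⟨f, hf, hfg⟩ := h fun i d => if i = j ∧ d = d' then 1 else 0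
    refine ⟨f, hf, ?_⟩
    rintro ⟨i, d, hd⟩
    rw [hfg i d hd]
    congr 1
    rw [eq_iff_iff]
    constructor
    · rintro ⟨rfl, rfl⟩; rfl
    · intro h
      cases h
      exact ⟨rfl, rfl⟩
  choose σ hσA hσ using hσ
  let M : Matrix κ κ (Polynomial k) := fun a b => ∑ p : initials t V, ∑ q ∈ triangle (t + 1),
    Polynomial.C (σ b p * (F p q * jet (Q a.1) a.2 q)) * Polynomial.X ^ (weight t q - weight t p)
  have hM : ∀ s a b, (M a b).eval s = ∑ p : initials t V, ∑ q ∈ triangle (t + 1),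
      σ b p * (F p q * jet (Q a.1) a.2 q) * s ^ (weight t q - weight t p) := by
    intro s a b
    simp [M, Polynomial.eval_finsetSum]
  have hdet : ∀ s, M.det.eval s = (M.map (Polynomial.eval s)).det := fun s => by
    rw [← Polynomial.coe_evalRingHom, RingHom.map_det]; rfl
  have hM0 : M.map (Polynomial.eval 0) = 1 := by
    ext a b
    rw [Matrix.map_apply, hM, Matrix.one_apply, ← hσ, coeff_translate_of_mem _ _ (hσA b),
      ← Finset.sum_coe_sort (initials t V)]
    refine Finset.sum_congr rfl fun p _ => ?_
    have hpT : (p : ℕ × ℕ) ∈ triangle (t + 1) := (mem_initials.1 p.2).1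
    rw [Finset.sum_eq_single (p : ℕ × ℕ)]
    · rw [hF1]; simp
    · intro q hq hqp
      rcases lt_trichotomy (weight t q) (weight t p) with hlt | heq | hgt
      · simp [hF0 p q hlt]
      · exact absurd (weight_injOn hq hpT heq) hqp
      · rw [zero_pow (by omega), mul_zero]
    · exact fun h => absurd hpT h
  have hdet0 : M.det * Polynomial.X ≠ 0 := by
    refine mul_ne_zero (fun h0 => ?_) Polynomial.X_ne_zero
    have := hdet 0
    rw [h0, hM0, Matrix.det_one] at this
    simp at this
  obtain ⟨s, hs⟩ : ∃ s, (M.det * Polynomial.X).eval s ≠ 0 := by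
    by_contra! hall
    exact hdet0 (Polynomial.funext fun s => by rw [hall s, Polynomial.eval_zero])
  rw [Polynomial.eval_mul, Polynomial.eval_X, hdet] at hs
  have hs0 : s ≠ 0 := right_ne_zero_of_mul hs
  have hunit : IsUnit (M.map (Polynomial.eval s)).det := (left_ne_zero_of_mul hs).isUnit
  refine ⟨s, hs0, imposes_maximalIdeal_pow_iff.2 fun g => ?_⟩
  set y := (M.map (Polynomial.eval s))⁻¹.mulVec (fun a : κ => s ^ weight t a.2 * g a.1 a.2) with hy
  have hMy : (M.map (Polynomial.eval s)).mulVec y = fun a : κ => s ^ weight t a.2 * g a.1 a.2 := by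
    rw [hy, Matrix.mulVec_mulVec, Matrix.mul_nonsing_inv _ hunit, Matrix.one_mulVec]
  refine ⟨∑ b, y b • ∑ p : initials t V, (σ b p * (s ^ weight t p)⁻¹) • F p,
    V.sum_mem fun b _ => V.smul_mem _ (V.sum_mem fun p _ => V.smul_mem _ (hFV p)), fun i d hd => ?_⟩
  have h1 := congrFun hMy ⟨i, d, hd⟩
  refine mul_left_cancel₀ (pow_ne_zero (weight t d) hs0) (Eq.trans ?_ h1)
  simp only [map_sum, map_smul, smul_eq_mul, Finset.mul_sum]
  rw [Matrix.mulVec, dotProduct]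
  refine Finset.sum_congr rfl fun b _ => ?_
  rw [Matrix.map_apply, hM, Finset.sum_mul]
  refine Finset.sum_congr rfl fun p _ => ?_
  rw [coeff_translate_of_mem _ _ (hV (hFV p)), Finset.mul_sum, Finset.mul_sum, Finset.mul_sum,
    Finset.sum_mul]
  refine Finset.sum_congr rfl fun q _ => ?_
  have h2 := pow_weight_mul_jet t s (Q i) d q
  have h3 : F p q * s ^ weight t q = F p q * s ^ (weight t q - weight t p) * s ^ weight t p := by
    rcases lt_or_ge (weight t q) (weight t p) with hlt | hge
    · simp [hF0 p q hlt]
    · rw [mul_assoc, ← pow_add, Nat.sub_add_cancel hge]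
  have h4 : (s ^ weight t p)⁻¹ * s ^ weight t p = 1 := inv_mul_cancel₀ (pow_ne_zero _ hs0)
  linear_combination (y b * σ b p * (s ^ weight t p)⁻¹ * F p q) * h2 +
    (y b * σ b p * (s ^ weight t p)⁻¹ * jet (Q i) d q) * h3 +
    (y b * σ b p * F p q * s ^ (weight t q - weight t p) * jet (Q i) d q) * h4

theorem finrank_le_finrank_inf_ker_add {k M N : Type*} [Field k] [AddCommGroup M] [Module k M]
    [AddCommGroup N] [Module k N] [Module.Finite k N] (V : Submodule k M) [Module.Finite k V]
    (φ : M →ₗ[k] N) :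
    Module.finrank k V ≤ Module.finrank k (V ⊓ LinearMap.ker φ : Submodule k M) +
      Module.finrank k N := by
  have h1 := LinearMap.finrank_range_add_finrank_ker (φ.domRestrict V)
  have h2 : Module.finrank k (LinearMap.ker (φ.domRestrict V)) =
      Module.finrank k (V ⊓ LinearMap.ker φ : Submodule k M) := by
    rw [LinearMap.ker_domRestrict, ← Submodule.map_comap_subtype,
      Submodule.finrank_map_subtype_eq]
  have h3 := Submodule.finrank_le (LinearMap.range (φ.domRestrict V))
  omega

/-- The polynomials in `V` that satisfy the conditions `I i` at the points `P i`. -/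
def vanishing {k : Type*} [Field k] {ι : Type*} (V : Submodule k (ℕ × ℕ →₀ k)) (P : ι → k × k)
    (I : ι → Ideal (MvPowerSeries (Fin 2) k)) : Submodule k (ℕ × ℕ →₀ k) where
  carrier := {f | f ∈ V ∧ ∀ i, translate (P i) f ∈ I i}
  zero_mem' := ⟨V.zero_mem, fun i => by simp⟩
  add_mem' := fun ha hb => ⟨V.add_mem ha.1 hb.1, fun i => by
    rw [map_add]; exact (I i).add_mem (ha.2 i) (hb.2 i)⟩
  smul_mem' := fun c f hf => ⟨V.smul_mem c hf.1, fun i => by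
    rw [map_smul, MvPowerSeries.smul_eq_C_mul]; exact (I i).mul_mem_left _ (hf.2 i)⟩

theorem vanishing_le {k : Type*} [Field k] {ι : Type*} (V : Submodule k (ℕ × ℕ →₀ k))
    (P : ι → k × k) (I : ι → Ideal (MvPowerSeries (Fin 2) k)) : vanishing V P I ≤ V :=
  fun _ h => h.1

theorem finrank_le_finrank_vanishing_add {k : Type*} [Field k] {ι : Type*} [Fintype ι]
    (V : Submodule k (ℕ × ℕ →₀ k)) [Module.Finite k V] (P : ι → k × k)
    (I : ι → Ideal (MvPowerSeries (Fin 2) k))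
    (hI : ∀ i, Module.Finite k (MvPowerSeries (Fin 2) k ⧸ I i)) :
    Module.finrank k V ≤ Module.finrank k (vanishing V P I) + ∑ i, germLength (I i) := by
  let φ : (ℕ × ℕ →₀ k) →ₗ[k] ∀ i, MvPowerSeries (Fin 2) k ⧸ I i :=
    LinearMap.pi fun i => (Ideal.Quotient.mkₐ k (I i)).toLinearMap ∘ₗ translate (P i)
  have h1 : V ⊓ LinearMap.ker φ = vanishing V P I := by
    ext f
    rw [Submodule.mem_inf, LinearMap.mem_ker]
    refine and_congr_right fun _ => ⟨fun h i => ?_, fun h => ?_⟩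
    · exact Ideal.Quotient.eq_zero_iff_mem.1 (congrFun h i)
    · funext i
      exact Ideal.Quotient.eq_zero_iff_mem.2 (h i)
  have h2 := finrank_le_finrank_inf_ker_add V φ
  rwa [h1, Module.finrank_pi_fintype] at h2

/-- Conditions that are independent on `V`, and further conditions that are independent on the
kernel of the first ones, are independent together. -/
theorem Imposes.sum {k : Type*} [Field k] {ι ι' : Type*} {V : Submodule k (ℕ × ℕ →₀ k)}
    {P : ι → k × k} {I : ι → Ideal (MvPowerSeries (Fin 2) k)} {P' : ι' → k × k}
    {I' : ι' → Ideal (MvPowerSeries (Fin 2) k)} (h : Imposes V P I)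
    (h' : Imposes (vanishing V P I) P' I') :
    Imposes V (Sum.elim P P') (Sum.elim I I') := by
  intro g
  obtain ⟨f, hf, hfg⟩ := h fun i => g (Sum.inl i)
  obtain ⟨f', hf', hfg'⟩ := h' fun i => g (Sum.inr i) - translate (P' i) f
  refine ⟨f + f', V.add_mem hf hf'.1, ?_⟩
  rintro (i | i)
  · have := (I i).add_mem (hfg i) (hf'.2 i)
    simpa [sub_add_eq_add_sub] using this
  · simp only [Sum.elim_inr, map_add]
    convert hfg' i using 1
    ring

theorem Imposes.cons {k : Type*} [Field k] {n : ℕ} {V : Submodule k (ℕ × ℕ →₀ k)}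
    {P₀ : k × k} {P : Fin n → k × k}
    {I : Fin (n + 1) → Ideal (MvPowerSeries (Fin 2) k)}
    (h : Imposes V (fun _ : Unit => P₀) fun _ => I 0)
    (h' : Imposes (vanishing V (fun _ : Unit => P₀) fun _ => I 0) P fun i => I i.succ) :
    Imposes V (Fin.cons P₀ P : Fin (n + 1) → k × k) I := by
  intro g
  obtain ⟨f, hf, hfg⟩ := h.sum h' (Sum.elim (fun _ => g 0) fun i => g i.succ)
  refine ⟨f, hf, fun i => ?_⟩
  refine Fin.cases ?_ (fun i => ?_) i
  · exact hfg (Sum.inl ())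
  · exact hfg (Sum.inr i)

/-! ### One fat point -/

/-- A linear relation with coefficients `c` between the Taylor coefficients at `(1, 1)` of the
monomials in `A` is a polynomial in the exponents, written in the basis of products of binomial coefficients,
that vanishes on `A`. -/
theorem imposes_supported_of_forall {k : Type*} [Field k] {A : Finset (ℕ × ℕ)} {n : ℕ}
    (h : ∀ c : ℕ × ℕ → k, (∃ d ∈ triangle n, c d ≠ 0) →
      ∃ p ∈ A, ∑ d ∈ triangle n, c d * (p.1.choose d.1 * p.2.choose d.2) ≠ 0) :
    Imposes (Finsupp.supported k k (A : Set (ℕ × ℕ))) (fun _ : Unit => (1, 1))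
      fun _ => IsLocalRing.maximalIdeal (MvPowerSeries (Fin 2) k) ^ n := by
  classical
  rw [imposes_maximalIdeal_pow_iff (n := fun _ : Unit => n)]
  let L : (ℕ × ℕ →₀ k) →ₗ[k] ({d // d ∈ triangle n} → k) :=
    LinearMap.pi fun d => MvPowerSeries.coeff (expo d) ∘ₗ translate (1, 1)
  have hL : (Finsupp.supported k k (A : Set (ℕ × ℕ))).map L = ⊤ := by
    by_contra hne
    obtain ⟨φ, hφ0, hφ⟩ := Submodule.exists_le_ker_of_lt_top _ (lt_top_iff_ne_top.2 hne)
    have hφs : ∀ x, φ x = ∑ d ∈ triangle n, (if hd : d ∈ triangle n then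
        φ (Pi.single ⟨d, hd⟩ 1) * x ⟨d, hd⟩ else 0) := by
      intro x
      rw [← Finset.sum_coe_sort (triangle n)]
      conv_lhs => rw [pi_eq_sum_univ' x]
      rw [map_sum]
      refine Finset.sum_congr rfl fun d _ => ?_
      rw [dif_pos d.2, map_smul, smul_eq_mul, mul_comm]
    refine hφ0 ?_
    by_contra hφ0
    obtain ⟨p, hp, hpne⟩ := h (fun d => if hd : d ∈ triangle n then
        φ (Pi.single ⟨d, hd⟩ 1) else 0) (by
      by_contra! hall
      refine hφ0 (LinearMap.ext fun x => ?_)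
      rw [hφs, LinearMap.zero_apply]
      refine Finset.sum_eq_zero fun d hd => ?_
      have := hall d hd
      rw [dif_pos hd] at this
      rw [dif_pos hd, this, zero_mul])
    refine hpne ?_
    have h1 : φ (L (Finsupp.single p 1)) = 0 :=
      hφ (Submodule.mem_map_of_mem (Finsupp.single_mem_supported k 1 hp))
    rw [hφs] at h1
    rw [← h1]
    refine Finset.sum_congr rfl fun d hd => ?_
    rw [dif_pos hd, dif_pos hd]
    change _ = _ * MvPowerSeries.coeff (expo d) (translate (1, 1) (Finsupp.single p 1))
    rw [coeff_translate, Finsupp.sum_single_index (by simp)]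
    simp [jet]
  intro g
  obtain ⟨f, hf, hfg⟩ : (fun d : {d // d ∈ triangle n} => g () d) ∈
      (Finsupp.supported k k (A : Set (ℕ × ℕ))).map L := hL ▸ Submodule.mem_top
  exact ⟨f, hf, fun _ d hd => congrFun hfg ⟨d, hd⟩⟩

/-- A polynomial of degree less than `n` that vanishes on more than `(n - 1) * (t + 1)` exponents in
the triangle is zero, by the Schwartz–Zippel lemma. -/
theorem exists_sum_choose_ne_zero {k : Type*} [Field k] [CharZero k] {A : Finset (ℕ × ℕ)} {n t : ℕ}
    (hA : A ⊆ triangle (t + 1)) (hcard : (n - 1) * (t + 1) < A.card) (c : ℕ × ℕ → k)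
    (hc : ∃ d ∈ triangle n, c d ≠ 0) :
    ∃ p ∈ A, ∑ d ∈ triangle n, c d * (p.1.choose d.1 * p.2.choose d.2) ≠ 0 := by
  classical
  by_contra! hall
  let b : Fin 2 → ℕ → MvPolynomial (Fin 2) k := fun i m =>
    ∏ j ∈ Finset.range m, (MvPolynomial.X i - MvPolynomial.C (j : k))
  let g : MvPolynomial (Fin 2) k := ∑ d ∈ triangle n,
    MvPolynomial.C (c d * ((d.1.factorial : k) * d.2.factorial)⁻¹) * (b 0 d.1 * b 1 d.2)
  have hb : ∀ i m, (b i m).totalDegree ≤ m := by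
    intro i m
    refine (MvPolynomial.totalDegree_finsetProd _ _).trans ?_
    refine (Finset.sum_le_card_nsmul _ _ 1 fun j _ => ?_).trans (by simp)
    refine (MvPolynomial.totalDegree_sub _ _).trans ?_
    rw [MvPolynomial.totalDegree_X, MvPolynomial.totalDegree_C]
    exact le_rfl
  have hg : g.totalDegree ≤ n - 1 := by
    refine MvPolynomial.totalDegree_finsetSum_le fun d hd => ?_
    refine (MvPolynomial.totalDegree_mul _ _).trans ?_
    refine (add_le_add le_rfl (MvPolynomial.totalDegree_mul _ _)).trans ?_
    have h0 := hb 0 d.1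
    have h1 := hb 1 d.2
    rw [mem_triangle] at hd
    rw [MvPolynomial.totalDegree_C]
    omega
  have hev : ∀ p : ℕ × ℕ, MvPolynomial.eval ![(p.1 : k), (p.2 : k)] g =
      ∑ d ∈ triangle n, c d * (p.1.choose d.1 * p.2.choose d.2) := by
    have hbe : ∀ (x : Fin 2 → k) i (m a : ℕ), x i = a →
        MvPolynomial.eval x (b i m) = m.factorial * a.choose m := by
      intro x i m a hx
      simp only [b, map_prod, map_sub, MvPolynomial.eval_X, MvPolynomial.eval_C, hx]
      rw [← descPochhammer_eval_eq_prod_range, descPochhammer_eval_eq_descFactorial,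
        Nat.descFactorial_eq_factorial_mul_choose, Nat.cast_mul]
    intro p
    simp only [g, map_sum, map_mul, MvPolynomial.eval_C]
    refine Finset.sum_congr rfl fun d _ => ?_
    rw [hbe _ 0 d.1 p.1 rfl, hbe _ 1 d.2 p.2 rfl]
    have h1 : (d.1.factorial : k) ≠ 0 := Nat.cast_ne_zero.2 d.1.factorial_ne_zero
    have h2 : (d.2.factorial : k) ≠ 0 := Nat.cast_ne_zero.2 d.2.factorial_ne_zero
    field_simp
  have hg0 : g ≠ 0 := by
    intro h0
    obtain ⟨d, hd, hdc⟩ := hc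
    have hzero : ∀ m, ∀ d ∈ triangle n, d.1 + d.2 = m → c d = 0 := by
      intro m
      induction m using Nat.strong_induction_on with
      | _ m ih =>
        rintro d hd rfl
        have h1 := hev d
        rw [h0, map_zero, Finset.sum_eq_single d] at h1
        · simpa using h1.symm
        · intro d' hd' hne
          by_cases hlt : d'.1 + d'.2 < d.1 + d.2
          · rw [ih _ hlt d' hd' rfl, zero_mul]
          · rcases lt_or_ge d.1 d'.1 with h2 | h2
            · simp [Nat.choose_eq_zero_of_lt h2]
            · rcases lt_or_ge d.2 d'.2 with h3 | h3
              · simp [Nat.choose_eq_zero_of_lt h3]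
              · exact absurd (Prod.ext (by omega) (by omega)) hne
        · exact fun h => absurd hd h
    exact hdc (hzero _ d hd rfl)
  let S : Finset k := (Finset.range (t + 1)).image (Nat.cast : ℕ → k)
  have hS : S.card = t + 1 := by
    rw [Finset.card_image_of_injective _ Nat.cast_injective, Finset.card_range]
  have hAle : A.card ≤ ((Fintype.piFinset fun _ : Fin 2 => S).filter
      fun f => MvPolynomial.eval f g = 0).card := by
    refine Finset.card_le_card_of_injOn (fun p => ![(p.1 : k), (p.2 : k)]) (fun p hp => ?_) ?_
    · have hpT := mem_triangle.1 (hA hp)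
      rw [Finset.mem_coe, Finset.mem_filter, Fintype.mem_piFinset]
      refine ⟨fun i => ?_, by rw [hev]; exact hall p hp⟩
      fin_cases i
      · exact Finset.mem_image_of_mem _ (Finset.mem_range.2 (by omega))
      · exact Finset.mem_image_of_mem _ (Finset.mem_range.2 (by omega))
    · intro p _ q _ hpq
      have h0 := congrFun hpq 0
      have h1 := congrFun hpq 1
      simp at h0 h1
      exact Prod.ext h0 h1
  have hsz := MvPolynomial.schwartz_zippel_totalDegree hg0 S
  rw [hS, div_le_div_iff₀ (by positivity) (by positivity)] at hsz
  have h3 : ((Fintype.piFinset fun _ : Fin 2 => S).filter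
      fun f => MvPolynomial.eval f g = 0).card * (t + 1) ≤ g.totalDegree * (t + 1) ^ 2 := by
    exact_mod_cast hsz
  have h4 : ((Fintype.piFinset fun _ : Fin 2 => S).filter
      fun f => MvPolynomial.eval f g = 0).card ≤ g.totalDegree * (t + 1) := by
    refine Nat.le_of_mul_le_mul_right (c := t + 1) ?_ (Nat.succ_pos t)
    calc _ ≤ _ := h3
      _ = _ := by ring
  have h5 := Nat.mul_le_mul_right (t + 1) hg
  omega

/-- In a space of polynomials of degree at most `t` and of dimension more than `(n - 1) * (t + 1)`,
any subscheme of an `n`-fold point imposes independent conditions at a suitable point. -/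
theorem exists_imposes_single {k : Type*} [Field k] [CharZero k] {n t : ℕ}
    {V : Submodule k (ℕ × ℕ →₀ k)}
    (hV : V ≤ Finsupp.supported k k (triangle (t + 1) : Set (ℕ × ℕ)))
    (hcard : (n - 1) * (t + 1) < Module.finrank k V) {I : Ideal (MvPowerSeries (Fin 2) k)}
    (hI : IsLocalRing.maximalIdeal (MvPowerSeries (Fin 2) k) ^ n ≤ I) :
    ∃ P : k × k, P.1 ≠ 0 ∧ P.2 ≠ 0 ∧ Imposes V (fun _ : Unit => P) fun _ => I := by
  have h1 := imposes_supported_of_forall (k := k) (n := n) (A := initials t V)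
    (exists_sum_choose_ne_zero (fun p hp => (mem_initials.1 hp).1)
      (hcard.trans_le (finrank_le_card_initials hV)))
  obtain ⟨s, hs, h2⟩ := Imposes.of_initials (n := fun _ : Unit => n) hV h1
  exact ⟨_, mul_ne_zero (pow_ne_zero _ hs) one_ne_zero, mul_ne_zero (pow_ne_zero _ hs) one_ne_zero,
    h2.mono fun _ => hI⟩

/-! ### Double points on sparse univariate polynomials -/

section DoublePoints

open Polynomial

/-- Two elements of different degrees have a nonzero Wronskian in characteristic zero. -/
theorem exists_wronskian_ne_zero {k : Type*} [Field k] [CharZero k] {U : Submodule k k[X]}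
    (hU : 2 ≤ Module.finrank k U) :
    ∃ f ∈ U, ∃ g ∈ U, f * derivative g - g * derivative f ≠ 0 := by
  obtain ⟨f, hf, g, hg, hf0, hg0, hfg⟩ : ∃ f ∈ U, ∃ g ∈ U, f ≠ 0 ∧ g ≠ 0 ∧
      f.natDegree ≠ g.natDegree := by
    have hne : U ≠ ⊥ := by
      rintro rfl
      simp at hU
    obtain ⟨f, hf, hf0⟩ := U.exists_mem_ne_zero_of_ne_bot hne
    obtain ⟨g, hg, hgf⟩ : ∃ g ∈ U, g ∉ Submodule.span k {f} := by
      by_contra! hall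
      have h1 := Submodule.finrank_mono (show U ≤ Submodule.span k {f} from hall)
      rw [finrank_span_singleton hf0] at h1
      omega
    have hg0 : g ≠ 0 := fun h => hgf (h ▸ Submodule.zero_mem _)
    by_cases hd : f.natDegree = g.natDegree
    · set c := g.leadingCoeff / f.leadingCoeff with hc
      have hc0 : c ≠ 0 := div_ne_zero (leadingCoeff_ne_zero.2 hg0) (leadingCoeff_ne_zero.2 hf0)
      have hh0 : g - C c * f ≠ 0 := fun h =>
        hgf (Submodule.mem_span_singleton.2 ⟨c, by rw [smul_eq_C_mul, ← sub_eq_zero.1 h]⟩)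
      have hlt : (g - C c * f).degree < g.degree := by
        refine degree_sub_lt_left ?_ hg0 ?_
        · rw [degree_C_mul hc0, degree_eq_natDegree hf0, degree_eq_natDegree hg0, hd]
        · rw [leadingCoeff_mul, leadingCoeff_C, hc,
            div_mul_cancel₀ _ (leadingCoeff_ne_zero.2 hf0)]
      refine ⟨f, hf, _, U.sub_mem hg (smul_eq_C_mul (R := k) c ▸ U.smul_mem c hf), hf0, hh0, ?_⟩
      rw [hd]
      exact (natDegree_lt_natDegree hh0 hlt).ne'
    · exact ⟨f, hf, g, hg, hf0, hg0, hd⟩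
  refine ⟨f, hf, g, hg, fun h0 => ?_⟩
  have hX : ∀ p : k[X], (X * derivative p).natDegree ≤ p.natDegree ∧
      (X * derivative p).coeff p.natDegree = p.natDegree * p.leadingCoeff := by
    intro p
    have hco : ∀ m, (X * derivative p).coeff m = m * p.coeff m := by
      intro m
      rcases m with _ | m
      · simp
      · rw [coeff_X_mul, coeff_derivative]; push_cast; ring
    refine ⟨natDegree_le_iff_coeff_eq_zero.2 fun m hm => ?_, hco _⟩
    rw [hco, coeff_eq_zero_of_natDegree_lt hm, mul_zero]
  have h1 : f * (X * derivative g) = (X * derivative f) * g := by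
    linear_combination X * h0
  have h2 := congrArg (fun p => coeff p (f.natDegree + g.natDegree)) h1
  rw [coeff_mul_add_eq_of_natDegree_le le_rfl (hX g).1,
    coeff_mul_add_eq_of_natDegree_le (hX f).1 le_rfl,
    (hX g).2, (hX f).2] at h2
  have h3 : ((g.natDegree : k) - f.natDegree) * (f.leadingCoeff * g.leadingCoeff) = 0 := by
    rw [← coeff_natDegree, ← coeff_natDegree] at *
    linear_combination h2
  rcases mul_eq_zero.1 h3 with h4 | h4
  · exact hfg (Nat.cast_injective (sub_eq_zero.1 h4)).symm
  · exact mul_ne_zero (leadingCoeff_ne_zero.2 hf0) (leadingCoeff_ne_zero.2 hg0) h4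

/-- On a space of dimension at least `2e`, the values and derivatives at `e` suitable points are
independent; on a space of dimension at least `e`, so are the values at the same points. -/
theorem exists_points_univariate {k : Type*} [Field k] [CharZero k] (e : ℕ) :
    ∀ U₁ U₂ : Submodule k k[X], Module.Finite k U₁ → Module.Finite k U₂ →
      2 * e ≤ Module.finrank k U₁ → e ≤ Module.finrank k U₂ →
      ∃ s : Fin e → k, (∀ v, s v ≠ 0) ∧
        (∀ α β : Fin e → k, ∃ f ∈ U₁, ∀ v, f.eval (s v) = α v ∧ (derivative f).eval (s v) = β v) ∧
        ∀ γ : Fin e → k, ∃ f ∈ U₂, ∀ v, f.eval (s v) = γ v := by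
  induction e with
  | zero =>
    intro U₁ U₂ _ _ _ _
    exact ⟨Fin.elim0, fun v => v.elim0, fun _ _ => ⟨0, U₁.zero_mem, fun v => v.elim0⟩,
      fun _ => ⟨0, U₂.zero_mem, fun v => v.elim0⟩⟩
  | succ e ih =>
    intro U₁ U₂ hfin₁ hfin₂ h₁ h₂
    obtain ⟨f, hf, g, hg, hW⟩ := exists_wronskian_ne_zero (U := U₁) (by omega)
    have hne : U₂ ≠ ⊥ := by
      rintro rfl
      simp at h₂
    obtain ⟨h, hh, hh0⟩ := U₂.exists_mem_ne_zero_of_ne_bot hne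
    obtain ⟨s₀, hs₀⟩ : ∃ s₀, ((f * derivative g - g * derivative f) * h * X).eval s₀ ≠ 0 := by
      by_contra! hall
      exact mul_ne_zero (mul_ne_zero hW hh0) X_ne_zero
        (Polynomial.funext fun s => by rw [hall s, eval_zero])
    rw [eval_mul, eval_mul, eval_X] at hs₀
    have hs0 : s₀ ≠ 0 := right_ne_zero_of_mul hs₀
    have hhs : h.eval s₀ ≠ 0 := right_ne_zero_of_mul (left_ne_zero_of_mul hs₀)
    have hWs : f.eval s₀ * (derivative g).eval s₀ - g.eval s₀ * (derivative f).eval s₀ ≠ 0 := by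
      simpa using left_ne_zero_of_mul (left_ne_zero_of_mul hs₀)
    let φ₁ : k[X] →ₗ[k] k × k := (leval s₀).prod (leval s₀ ∘ₗ derivative)
    have hr₁ := finrank_le_finrank_inf_ker_add U₁ φ₁
    have hr₂ := finrank_le_finrank_inf_ker_add U₂ (leval s₀)
    rw [Module.finrank_prod, Module.finrank_self] at hr₁
    rw [Module.finrank_self] at hr₂
    obtain ⟨s, hs, hs₁, hs₂⟩ := ih (U₁ ⊓ LinearMap.ker φ₁) (U₂ ⊓ LinearMap.ker (leval s₀))
      (Submodule.finiteDimensional_of_le inf_le_left)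
      (Submodule.finiteDimensional_of_le inf_le_left) (by omega) (by omega)
    refine ⟨Fin.cons s₀ s, fun v => Fin.cases hs0 hs v, fun α β => ?_, fun γ => ?_⟩
    · set D := f.eval s₀ * (derivative g).eval s₀ - g.eval s₀ * (derivative f).eval s₀ with hD
      set q := ((α 0 * (derivative g).eval s₀ - β 0 * g.eval s₀) / D) • f +
        ((β 0 * f.eval s₀ - α 0 * (derivative f).eval s₀) / D) • g with hq
      have hqU : q ∈ U₁ := U₁.add_mem (U₁.smul_mem _ hf) (U₁.smul_mem _ hg)
      have hq0 : q.eval s₀ = α 0 := by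
        rw [hq, eval_add, eval_smul, eval_smul, smul_eq_mul, smul_eq_mul]
        field_simp
        rw [hD]; ring
      have hq1 : (derivative q).eval s₀ = β 0 := by
        rw [hq, derivative_add, derivative_smul, derivative_smul, eval_add, eval_smul, eval_smul,
          smul_eq_mul, smul_eq_mul]
        field_simp
        rw [hD]; ring
      obtain ⟨u, hu, hus⟩ := hs₁ (fun v => α v.succ - q.eval (s v))
        fun v => β v.succ - (derivative q).eval (s v)
      have hu0 : u.eval s₀ = 0 ∧ (derivative u).eval s₀ = 0 := Prod.ext_iff.1 hu.2
      refine ⟨q + u, U₁.add_mem hqU hu.1, fun v => ?_⟩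
      refine Fin.cases ?_ (fun v => ?_) v
      · simp [hq0, hq1, hu0.1, hu0.2]
      · simp [(hus v).1, (hus v).2]
    · set q := (γ 0 / h.eval s₀) • h with hq
      have hq0 : q.eval s₀ = γ 0 := by
        rw [hq, eval_smul, smul_eq_mul, div_mul_cancel₀ _ hhs]
      obtain ⟨u, hu, hus⟩ := hs₂ fun v => γ v.succ - q.eval (s v)
      have hu0 : u.eval s₀ = 0 := hu.2
      refine ⟨q + u, U₂.add_mem (U₂.smul_mem _ hh) hu.1, fun v => ?_⟩
      refine Fin.cases ?_ (fun v => ?_) v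
      · simp [hq0, hu0]
      · simp [hus v]

/-! ### Double points -/

theorem finrank_span_X_pow_weight {k : Type*} [Field k] {t : ℕ} {A : Finset (ℕ × ℕ)}
    (hA : A ⊆ triangle (t + 1)) :
    Module.finrank k (Submodule.span k ((fun p => (X : k[X]) ^ weight t p) '' (A : Set (ℕ × ℕ)))) =
      A.card := by
  have hli : LinearIndependent k fun p : A => (X : k[X]) ^ weight t p := by
    have h1 := (basisMonomials k).linearIndependent.comp (fun p : A => weight t p)
      (fun p q h => Subtype.ext (weight_injOn (hA p.2) (hA q.2) h))
    convert h1 using 1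
    funext p
    simp [X_pow_eq_monomial]
  have h2 := finrank_span_eq_card hli
  rw [Fintype.card_coe] at h2
  rw [← h2, Set.image_eq_range]
  rfl

/-- If `2e` of the exponents in `A` lie on a line and at least `e` do not, then `e` double points
impose independent conditions on the span of the monomials. On the points of the
curve `s ↦ (s ^ (t + 1), s ^ (t + 2))` the equation of the line splits off one condition per point,
on the exponents outside the line, and the other two are values and derivatives on the line. -/
theorem exists_imposes_double_of_line {k : Type*} [Field k] [CharZero k] {t e : ℕ}
    {A : Finset (ℕ × ℕ)} (hA : A ⊆ triangle (t + 1)) (he : 0 < e) (a b c : k) [DecidableEq k]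
    (h₁ : 2 * e ≤ (A.filter fun p => a + b * p.1 + c * p.2 = 0).card)
    (h₂ : e ≤ (A.filter fun p => a + b * p.1 + c * p.2 ≠ 0).card) :
    ∃ Q : Fin e → k × k, Imposes (Finsupp.supported k k (A : Set (ℕ × ℕ))) Q
      fun _ => IsLocalRing.maximalIdeal (MvPowerSeries (Fin 2) k) ^ 2 := by
  set A₁ := A.filter fun p => a + b * p.1 + c * p.2 = 0 with hA₁
  set A₂ := A.filter fun p => a + b * p.1 + c * p.2 ≠ 0 with hA₂
  have hdet : b * (t + 2) - c * (t + 1) ≠ 0 := by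
    intro hdet
    obtain ⟨p, hp, q, hq, hpq⟩ := Finset.one_lt_card.1 (show 1 < A₁.card by omega)
    obtain ⟨r, hr⟩ := Finset.card_pos.1 (show 0 < A₂.card by omega)
    rw [hA₁, Finset.mem_filter] at hp hq
    rw [hA₂, Finset.mem_filter] at hr
    have ht : ((t : k) + 2) ≠ 0 := by exact_mod_cast (show t + 2 ≠ 0 by omega)
    rcases eq_or_ne c 0 with rfl | hc
    · have hb : b = 0 := by
        have : b * (t + 2 : k) = 0 := by linear_combination hdet
        exact (mul_eq_zero.1 this).resolve_right ht
      subst hb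
      refine hr.2 ?_
      linear_combination hp.2
    · have h3 : c * ((weight t p : k) - weight t q) = 0 := by
        simp only [weight]; push_cast
        linear_combination (t + 2 : k) * (hp.2 - hq.2) - ((p.1 : k) - q.1) * hdet
      have h4 := sub_eq_zero.1 ((mul_eq_zero.1 h3).resolve_left hc)
      exact hpq (weight_injOn (hA hp.1) (hA hq.1) (Nat.cast_injective h4))
  have hfin : ∀ B : Finset (ℕ × ℕ), Module.Finite k
      (Submodule.span k ((fun p => (X : k[X]) ^ weight t p) '' (B : Set (ℕ × ℕ)))) := fun B =>
    FiniteDimensional.span_of_finite k (B.finite_toSet.image _)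
  obtain ⟨s, hs, hs₁, hs₂⟩ := exists_points_univariate e _ _ (hfin A₁) (hfin A₂)
    (by rw [finrank_span_X_pow_weight ((Finset.filter_subset _ _).trans hA)]; exact h₁)
    (by rw [finrank_span_X_pow_weight ((Finset.filter_subset _ _).trans hA)]; exact h₂)
  let Q : Fin e → k × k := fun v => (s v ^ (t + 1), s v ^ (t + 2))
  have hQ : ∀ v (p : ℕ × ℕ), (Q v).1 ^ p.1 * (Q v).2 ^ p.2 = s v ^ weight t p := by
    intro v p
    simp only [Q, weight]
    rw [← pow_mul, ← pow_mul, ← pow_add]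
  refine ⟨Q, (imposes_maximalIdeal_pow_iff (n := fun _ => 2)).2 fun g => ?_⟩
  obtain ⟨f₂, hf₂, hfs₂⟩ := hs₂ fun v =>
    a * g v (0, 0) + b * ((Q v).1 * g v (1, 0)) + c * ((Q v).2 * g v (0, 1))
  obtain ⟨c₂, rfl⟩ := (Submodule.mem_span_image_finset_iff_exists_fun' k).1 hf₂
  let F₂ : ℕ × ℕ → k := fun p => c₂ p / (a + b * p.1 + c * p.2)
  obtain ⟨f₁, hf₁, hfs₁⟩ := hs₁ (fun v => g v (0, 0) - ∑ p ∈ A₂, F₂ p * s v ^ weight t p)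
    fun v => ((t + 1) * ((Q v).1 * g v (1, 0)) + (t + 2) * ((Q v).2 * g v (0, 1)) -
      ∑ p ∈ A₂, F₂ p * (weight t p * s v ^ weight t p)) / s v
  obtain ⟨c₁, rfl⟩ := (Submodule.mem_span_image_finset_iff_exists_fun' k).1 hf₁
  let F : ℕ × ℕ → k := fun p => if a + b * p.1 + c * p.2 = 0 then c₁ p else F₂ p
  have hsplit : ∀ G : ℕ × ℕ → k, ∑ p ∈ A, F p * G p =
      ∑ p ∈ A₁, c₁ p * G p + ∑ p ∈ A₂, F₂ p * G p := by
    intro G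
    rw [← Finset.sum_filter_add_sum_filter_not A (fun p => a + b * p.1 + c * p.2 = 0)]
    congr 1
    · refine Finset.sum_congr rfl fun p hp => ?_
      simp only [F, if_pos (Finset.mem_filter.1 hp).2]
    · refine Finset.sum_congr rfl fun p hp => ?_
      simp only [F, if_neg (Finset.mem_filter.1 hp).2]
  have hmem : Finsupp.indicator A (fun p _ => F p) ∈
      Finsupp.supported k k (A : Set (ℕ × ℕ)) := by
    rw [Finsupp.mem_supported]
    exact Finset.coe_subset.2 (Finsupp.support_indicator_subset _ _)
  have hco : ∀ v d, MvPowerSeries.coeff (expo d)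
      (translate (Q v) (Finsupp.indicator A fun p _ => F p)) = ∑ p ∈ A, F p * jet (Q v) d p := by
    intro v d
    rw [coeff_translate_of_mem _ _ hmem]
    exact Finset.sum_congr rfl fun p hp => by rw [Finsupp.indicator_of_mem hp]
  refine ⟨_, hmem, fun v d hd => ?_⟩
  have hQ1 : (Q v).1 ≠ 0 := pow_ne_zero _ (hs v)
  have hQ2 : (Q v).2 ≠ 0 := pow_ne_zero _ (hs v)
  have e00 : ∑ p ∈ A, F p * jet (Q v) (0, 0) p = ∑ p ∈ A, F p * s v ^ weight t p :=
    Finset.sum_congr rfl fun p _ => by rw [← hQ]; simp [jet]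
  have e10 : (Q v).1 * ∑ p ∈ A, F p * jet (Q v) (1, 0) p =
      ∑ p ∈ A, F p * (p.1 * s v ^ weight t p) := by
    rw [Finset.mul_sum]
    refine Finset.sum_congr rfl fun p _ => ?_
    rw [← hQ, jet]
    rcases p with ⟨_ | i, j⟩
    · simp
    · simp [pow_succ]; ring
  have e01 : (Q v).2 * ∑ p ∈ A, F p * jet (Q v) (0, 1) p =
      ∑ p ∈ A, F p * (p.2 * s v ^ weight t p) := by
    rw [Finset.mul_sum]
    refine Finset.sum_congr rfl fun p _ => ?_
    rw [← hQ, jet]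
    rcases p with ⟨i, _ | j⟩
    · simp
    · simp [pow_succ]; ring
  -- the value, the equation of the line, and the derivative along the curve
  have q1 : ∑ p ∈ A, F p * s v ^ weight t p = g v (0, 0) := by
    have h1 := (hfs₁ v).1
    simp only [eval_finsetSum, eval_smul, eval_pow, eval_X, smul_eq_mul] at h1
    rw [hsplit, h1]; ring
  have q2 : a * (∑ p ∈ A, F p * s v ^ weight t p) +
      b * (∑ p ∈ A, F p * (p.1 * s v ^ weight t p)) +
      c * (∑ p ∈ A, F p * (p.2 * s v ^ weight t p)) =
      a * g v (0, 0) + b * ((Q v).1 * g v (1, 0)) + c * ((Q v).2 * g v (0, 1)) := by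
    rw [← hfs₂ v]
    simp only [eval_finsetSum, eval_smul, eval_pow, eval_X, smul_eq_mul]
    have h1 : ∀ p ∈ A₂, F₂ p * ((a + b * p.1 + c * p.2) * s v ^ weight t p) =
        c₂ p * s v ^ weight t p := fun p hp => by
      rw [← mul_assoc, div_mul_cancel₀ _ (Finset.mem_filter.1 hp).2]
    have h2 : ∀ p ∈ A₁, c₁ p * ((a + b * p.1 + c * p.2) * s v ^ weight t p) = 0 := fun p hp => by
      rw [(Finset.mem_filter.1 hp).2]; ring
    rw [← Finset.sum_congr rfl h1, ← zero_add (∑ p ∈ A₂, _), ← Finset.sum_eq_zero h2, ← hsplit,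
      Finset.mul_sum, Finset.mul_sum, Finset.mul_sum, ← Finset.sum_add_distrib,
      ← Finset.sum_add_distrib]
    exact Finset.sum_congr rfl fun p _ => by ring
  have q3 : (t + 1) * (∑ p ∈ A, F p * (p.1 * s v ^ weight t p)) +
      (t + 2) * (∑ p ∈ A, F p * (p.2 * s v ^ weight t p)) =
      (t + 1) * ((Q v).1 * g v (1, 0)) + (t + 2) * ((Q v).2 * g v (0, 1)) := by
    have h1 := (hfs₁ v).2
    rw [eq_div_iff (hs v)] at h1
    simp only [derivative_sum, derivative_smul, derivative_X_pow, eval_finsetSum, eval_smul,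
      eval_mul, eval_C, eval_pow, eval_X, smul_eq_mul, Finset.sum_mul] at h1
    have h2 : ∀ p ∈ A₁, c₁ p * ((weight t p : k) * s v ^ (weight t p - 1)) * s v =
        c₁ p * (weight t p * s v ^ weight t p) := fun p _ => by
      rcases Nat.eq_zero_or_pos (weight t p) with h0 | h0
      · simp [h0]
      · rw [mul_assoc, mul_assoc, ← pow_succ, Nat.sub_add_cancel h0]
    rw [Finset.sum_congr rfl h2] at h1
    have h3 := hsplit fun p => weight t p * s v ^ weight t p
    rw [h1, sub_add_cancel] at h3
    rw [← h3, Finset.mul_sum, Finset.mul_sum, ← Finset.sum_add_distrib]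
    refine Finset.sum_congr rfl fun p _ => ?_
    simp only [weight]; push_cast
    ring
  rw [← e10, ← e01] at q2 q3
  rw [q1] at q2
  rw [hco]
  have hd' : d = (0, 0) ∨ d = (1, 0) ∨ d = (0, 1) := by
    rw [mem_triangle] at hd
    rcases d with ⟨i, j⟩
    simp only [Prod.mk.injEq] at hd ⊢
    omega
  rcases hd' with rfl | rfl | rfl
  · rw [e00, q1]
  · refine mul_left_cancel₀ (mul_ne_zero hdet hQ1) ?_
    linear_combination (t + 2 : k) * q2 - c * q3
  · refine mul_left_cancel₀ (mul_ne_zero hdet hQ2) ?_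
    linear_combination b * q3 - (t + 1 : k) * q2

/-- Double points on a space of polynomials of degree at most `t` whose initial exponents are not
too close to being collinear. If many of them are collinear, all points are placed at once;
otherwise one point is placed, and the exponents that are left are still not too close to being
collinear. -/
theorem exists_imposes_double {k : Type*} [Field k] [CharZero k] [DecidableEq k] {t : ℕ} (e : ℕ) :
    ∀ V : Submodule k (ℕ × ℕ →₀ k),
      V ≤ Finsupp.supported k k (triangle (t + 1) : Set (ℕ × ℕ)) → 3 * e + 1 ≤ Module.finrank k V →
      (∀ a b c : k, (a ≠ 0 ∨ b ≠ 0 ∨ c ≠ 0) →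
        e ≤ ((initials t V).filter fun p => a + b * p.1 + c * p.2 ≠ 0).card) →
      ∃ Q : Fin e → k × k, Imposes V Q
        fun _ => IsLocalRing.maximalIdeal (MvPowerSeries (Fin 2) k) ^ 2 := by
  induction e with
  | zero => exact fun V _ _ _ => ⟨Fin.elim0, fun _ => ⟨0, V.zero_mem, fun i => i.elim0⟩⟩
  | succ e ih =>
    intro V hV hdim hline
    have hAT : initials t V ⊆ triangle (t + 1) := fun p hp => (mem_initials.1 hp).1
    by_cases hmany : ∃ a b c : k, (a ≠ 0 ∨ b ≠ 0 ∨ c ≠ 0) ∧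
        2 * (e + 1) ≤ ((initials t V).filter fun p => a + b * p.1 + c * p.2 = 0).card
    · obtain ⟨a, b, c, h0, hc⟩ := hmany
      obtain ⟨Q, hQ⟩ := exists_imposes_double_of_line hAT (Nat.succ_pos e) a b c hc (hline a b c h0)
      obtain ⟨s, -, hs⟩ := Imposes.of_initials (n := fun _ : Fin (e + 1) => 2) hV hQ
      exact ⟨_, hs⟩
    push Not at hmany
    have htri : triangle 2 = {(0, 0), (1, 0), (0, 1)} := by decide
    have hone : Imposes (Finsupp.supported k k (initials t V : Set (ℕ × ℕ)))
        (fun _ : Unit => (1, 1))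
        fun _ => IsLocalRing.maximalIdeal (MvPowerSeries (Fin 2) k) ^ 2 := by
      refine imposes_supported_of_forall fun c hc => ?_
      have h1 := hline (c (0, 0)) (c (1, 0)) (c (0, 1)) (by simpa [htri] using hc)
      obtain ⟨p, hp⟩ := Finset.card_pos.1 (lt_of_lt_of_le (Nat.succ_pos e) h1)
      rw [Finset.mem_filter] at hp
      refine ⟨p, hp.1, ?_⟩
      rw [htri]
      simpa [add_assoc] using hp.2
    obtain ⟨s, -, hs⟩ := Imposes.of_initials (n := fun _ : Unit => 2) hV hone
    have hfinV : Module.Finite k V := by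
      have : Module.Finite k (Finsupp.supported k k (triangle (t + 1) : Set (ℕ × ℕ))) :=
        Module.Finite.equiv (Finsupp.supportedEquivFinsupp _).symm
      exact Submodule.finiteDimensional_of_le hV
    have hq := finite_quotient_of_maximalIdeal_pow_le (k := k) (n := 2) le_rfl
    have hdim' := finrank_le_finrank_vanishing_add V
      (fun _ : Unit => (s ^ (t + 1) * (1 : k), s ^ (t + 2) * (1 : k)))
      (fun _ => IsLocalRing.maximalIdeal (MvPowerSeries (Fin 2) k) ^ 2) fun _ => hq.1
    have h3 : (triangle 2).card = 3 := by decide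
    rw [h3] at hq
    rw [Fintype.sum_unique, germLength] at hdim'
    set V' := vanishing V (fun _ : Unit => (s ^ (t + 1) * (1 : k), s ^ (t + 2) * (1 : k)))
      (fun _ => IsLocalRing.maximalIdeal (MvPowerSeries (Fin 2) k) ^ 2) with hV'
    have hV'V : V' ≤ V := vanishing_le _ _ _
    obtain ⟨Q, hQ⟩ := ih V' (hV'V.trans hV) (by omega) (fun a b c h0 => by
      have h4 := finrank_le_card_initials (hV'V.trans hV)
      have h5 := Finset.card_filter_add_card_filter_not (s := initials t V')
        (fun p => a + b * p.1 + c * p.2 = 0)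
      have h6 := Finset.card_le_card (Finset.filter_subset_filter
        (fun p : ℕ × ℕ => a + b * p.1 + c * p.2 = 0) (initials_mono (t := t) hV'V))
      have h7 := hmany a b c h0
      simp only [ne_eq]
      omega)
    exact ⟨_, Imposes.cons (I := fun _ => _) hs hQ⟩

end DoublePoints

/-! ### Multiplicity and length -/

theorem le_of_finrank_quotient_le {k : Type*} [Field k] {I J : Ideal (MvPowerSeries (Fin 2) k)}
    (hIJ : I ≤ J) [Module.Finite k (MvPowerSeries (Fin 2) k ⧸ I)]
    (h : Module.finrank k (MvPowerSeries (Fin 2) k ⧸ I) ≤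
      Module.finrank k (MvPowerSeries (Fin 2) k ⧸ J)) : J ≤ I := by
  let φ := (Ideal.Quotient.factorₐ k hIJ).toLinearMap
  have hs : Function.Surjective φ := Ideal.Quotient.factor_surjective hIJ
  have : Module.Finite k (MvPowerSeries (Fin 2) k ⧸ J) := Module.Finite.of_surjective φ hs
  have hle := LinearMap.finrank_le_finrank_of_surjective hs
  have hinj : Function.Injective φ :=
    (LinearMap.injective_iff_surjective_of_finrank_eq_finrank (le_antisymm h hle)).2 hs
  intro x hx
  refine Ideal.Quotient.eq_zero_iff_mem.1 (hinj ?_)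
  rw [map_zero]
  exact Ideal.Quotient.eq_zero_iff_mem.2 hx

/-- The multiplicity is attained: the set whose infimum defines it is not empty. -/
theorem maximalIdeal_pow_germMult_le {k : Type*} [Field k] {I : Ideal (MvPowerSeries (Fin 2) k)}
    (hI : IsZeroDimGerm I) :
    IsLocalRing.maximalIdeal (MvPowerSeries (Fin 2) k) ^ germMult I ≤ I := by
  have := hI.2
  have : IsArtinianRing (MvPowerSeries (Fin 2) k ⧸ I) := IsArtinianRing.of_finite k _
  exact Nat.sInf_mem (s := {m | IsLocalRing.maximalIdeal (MvPowerSeries (Fin 2) k) ^ m ≤ I})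
    (IsLocalRing.exists_maximalIdeal_pow_le_of_isArtinianRing_quotient I)

/-- The ideals `I + 𝔪 ^ j` decrease strictly until they reach `I`. -/
theorem germMult_le_germLength {k : Type*} [Field k] {I : Ideal (MvPowerSeries (Fin 2) k)}
    (hI : IsZeroDimGerm I) : germMult I ≤ germLength I := by
  have hfin := hI.2
  set 𝔪 := IsLocalRing.maximalIdeal (MvPowerSeries (Fin 2) k)
  have hfinJ : ∀ j, Module.Finite k (MvPowerSeries (Fin 2) k ⧸ (I ⊔ 𝔪 ^ j)) := fun j =>
    Module.Finite.of_surjective (Ideal.Quotient.factorₐ k le_sup_left).toLinearMap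
      (Ideal.Quotient.factor_surjective le_sup_left)
  have hstep : ∀ j, 𝔪 ^ j ≤ I ⊔ 𝔪 ^ (j + 1) → 𝔪 ^ j ≤ I := by
    intro j hj
    have h1 : ∀ i, 𝔪 ^ j ≤ I ⊔ 𝔪 ^ (j + i) := by
      intro i
      induction i with
      | zero => exact le_sup_right
      | succ i ih =>
        refine ih.trans (sup_le le_sup_left ?_)
        calc 𝔪 ^ (j + i) = 𝔪 ^ i * 𝔪 ^ j := by rw [← pow_add, add_comm]
          _ ≤ 𝔪 ^ i * (I ⊔ 𝔪 ^ (j + 1)) := Ideal.mul_mono_right hj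
          _ = 𝔪 ^ i * I ⊔ 𝔪 ^ i * 𝔪 ^ (j + 1) := Ideal.mul_sup _ _ _
          _ ≤ I ⊔ 𝔪 ^ (j + (i + 1)) := by
            refine sup_le_sup Ideal.mul_le_right (le_of_eq ?_)
            rw [← pow_add]
            congr 1
            ring
    refine (h1 (germMult I)).trans (sup_le le_rfl ?_)
    exact (Ideal.pow_le_pow_right (Nat.le_add_left _ _)).trans (maximalIdeal_pow_germMult_le hI)
  have hlow : ∀ j, ¬ 𝔪 ^ j ≤ I → j ≤ Module.finrank k (MvPowerSeries (Fin 2) k ⧸ (I ⊔ 𝔪 ^ j)) := by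
    intro j
    induction j with
    | zero => exact fun _ => Nat.zero_le _
    | succ j ih =>
      intro hj
      have hj' : ¬ 𝔪 ^ j ≤ I := fun h => hj ((Ideal.pow_le_pow_right (Nat.le_succ j)).trans h)
      have h1 := ih hj'
      by_contra! hlt
      have hle : I ⊔ 𝔪 ^ (j + 1) ≤ I ⊔ 𝔪 ^ j :=
        sup_le_sup le_rfl (Ideal.pow_le_pow_right (Nat.le_succ j))
      exact hj' (hstep j (le_sup_right.trans (le_of_finrank_quotient_le hle (by omega))))
  refine Nat.sInf_le ?_
  by_contra hnot
  have h1 := hlow _ hnot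
  exact hnot (le_sup_right.trans (le_of_finrank_quotient_le le_sup_left h1))

/-! ### Placing the given subschemes -/

theorem finite_supported {k : Type*} [Field k] (A : Finset (ℕ × ℕ)) :
    Module.Finite k (Finsupp.supported k k (A : Set (ℕ × ℕ))) :=
  Module.Finite.equiv (Finsupp.supportedEquivFinsupp _).symm

theorem finrank_supported {k : Type*} [Field k] (A : Finset (ℕ × ℕ)) :
    Module.finrank k (Finsupp.supported k k (A : Set (ℕ × ℕ))) = A.card := by
  rw [LinearEquiv.finrank_eq (Finsupp.supportedEquivFinsupp (A : Set (ℕ × ℕ)))]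
  simp

theorem card_triangle (n : ℕ) : 2 * (triangle n).card = n * (n + 1) := by
  induction n with
  | zero => simp [triangle]
  | succ n ih =>
    have h1 : triangle (n + 1) = triangle n ∪ Finset.HasAntidiagonal.antidiagonal n := by
      ext p
      simp only [Finset.mem_union, mem_triangle, Finset.HasAntidiagonal.mem_antidiagonal]
      omega
    have h2 : Disjoint (triangle n) (Finset.HasAntidiagonal.antidiagonal n) := by
      rw [Finset.disjoint_left]
      intro p hp hp'
      rw [mem_triangle] at hp
      rw [Finset.HasAntidiagonal.mem_antidiagonal] at hp'
      omega
    rw [h1, Finset.card_union_of_disjoint h2, Finset.Nat.card_antidiagonal, mul_add, ih]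
    ring

theorem coeff_translate_zero {k : Type*} [Field k] (d : ℕ × ℕ) (f : ℕ × ℕ →₀ k) :
    MvPowerSeries.coeff (expo d) (translate (0, 0) f) = f d := by
  rw [coeff_translate, Finsupp.sum, Finset.sum_eq_single d]
  · simp [jet]
  · intro q _ hq
    rcases lt_trichotomy q.1 d.1 with h | h | h
    · simp [jet, Nat.choose_eq_zero_of_lt h]
    · rcases lt_trichotomy q.2 d.2 with h' | h' | h'
      · simp [jet, Nat.choose_eq_zero_of_lt h']
      · exact absurd (Prod.ext h h') hq
      · simp [jet, Nat.sub_ne_zero_of_lt h']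
    · simp [jet, Nat.sub_ne_zero_of_lt h]
  · intro h
    simp [Finsupp.notMem_support_iff.1 h]

/-- At the origin polynomials interpolate by truncation of power series. -/
theorem imposes_origin {k : Type*} [Field k] {n t : ℕ} (hn : n ≤ t + 1)
    {I : Ideal (MvPowerSeries (Fin 2) k)}
    (hI : IsLocalRing.maximalIdeal (MvPowerSeries (Fin 2) k) ^ n ≤ I) :
    Imposes (Finsupp.supported k k (triangle (t + 1) : Set (ℕ × ℕ))) (fun _ : Unit => (0, 0))
      fun _ => I := by
  refine Imposes.mono ((imposes_maximalIdeal_pow_iff (n := fun _ : Unit => n)).2 fun g => ?_)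
    fun _ => hI
  refine ⟨Finsupp.indicator (triangle n) fun d _ => g () d, ?_, fun _ d hd => ?_⟩
  · rw [Finsupp.mem_supported]
    refine Finset.coe_subset.2 ((Finsupp.support_indicator_subset _ _).trans fun d hd => ?_)
    rw [mem_triangle] at hd ⊢
    omega
  · rw [coeff_translate_zero, Finsupp.indicator_of_mem hd]

/-- Subschemes of total length at most `dim V - D` can be placed one after the other. -/
theorem exists_imposes_of_finrank {k : Type*} [Field k] [CharZero k] {t D : ℕ} (r : ℕ) :
    ∀ (V : Submodule k (ℕ × ℕ →₀ k)) (I : Fin r → Ideal (MvPowerSeries (Fin 2) k)) (n : Fin r → ℕ),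
      V ≤ Finsupp.supported k k (triangle (t + 1) : Set (ℕ × ℕ)) →
      (∀ i, IsLocalRing.maximalIdeal (MvPowerSeries (Fin 2) k) ^ n i ≤ I i) →
      D + ∑ i, germLength (I i) ≤ Module.finrank k V →
      (∀ i, (n i - 1) * (t + 1) < D + germLength (I i)) →
      ∃ P : Fin r → k × k, (∀ i, (P i).2 ≠ 0) ∧ Imposes V P I := by
  induction r with
  | zero =>
    exact fun V _ _ _ _ _ _ => ⟨Fin.elim0, fun i => i.elim0,
      fun _ => ⟨0, V.zero_mem, fun i => i.elim0⟩⟩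
  | succ r ih =>
    intro V I n hV hI hdim hn
    rw [Fin.sum_univ_succ] at hdim
    obtain ⟨P₀, -, hP₀, h₀⟩ := exists_imposes_single hV (lt_of_lt_of_le (hn 0) (by omega)) (hI 0)
    have hfinV : Module.Finite k V := by
      have := finite_supported (k := k) (triangle (t + 1))
      exact Submodule.finiteDimensional_of_le hV
    have h1 := finrank_le_finrank_vanishing_add V (fun _ : Unit => P₀) (fun _ => I 0)
      fun _ => (finite_quotient_of_maximalIdeal_pow_le (hI 0)).1
    rw [Fintype.sum_unique] at h1
    obtain ⟨P, hP, h⟩ := ih (vanishing V (fun _ : Unit => P₀) fun _ => I 0) (fun i => I i.succ)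
      (fun i => n i.succ) ((vanishing_le _ _ _).trans hV) (fun i => hI i.succ) (by omega)
      fun i => hn i.succ
    exact ⟨Fin.cons P₀ P, fun i => Fin.cases hP₀ hP i, Imposes.cons h₀ h⟩

/-! ### Lines in the triangle of exponents -/

theorem card_le_of_forall_line {k : Type*} [Field k] [CharZero k] {t : ℕ} {B : Finset (ℕ × ℕ)}
    (hB : B ⊆ triangle (t + 1)) {a b c : k} (h0 : a ≠ 0 ∨ b ≠ 0 ∨ c ≠ 0)
    (hl : ∀ p ∈ B, a + b * p.1 + c * p.2 = 0) : B.card ≤ t + 1 := by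
  have hT : ∀ p ∈ B, p.1 + p.2 < t + 1 := fun p hp => mem_triangle.1 (hB hp)
  rw [← Finset.card_range (t + 1)]
  by_cases hc : c = 0
  · subst hc
    by_cases hb : b = 0
    · subst hb
      have ha : a ≠ 0 := by simpa using h0
      have : B = ∅ := Finset.eq_empty_of_forall_notMem fun p hp => ha (by simpa using hl p hp)
      simp [this]
    · refine Finset.card_le_card_of_injOn Prod.snd (fun p hp => Finset.mem_coe.2
        (Finset.mem_range.2 (by have := hT p hp; omega))) fun p hp q hq hpq => ?_
      have h1 : b * ((p.1 : k) - q.1) = 0 := by linear_combination hl p hp - hl q hq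
      have h2 := sub_eq_zero.1 ((mul_eq_zero.1 h1).resolve_left hb)
      exact Prod.ext (Nat.cast_injective h2) hpq
  · refine Finset.card_le_card_of_injOn Prod.fst (fun p hp => Finset.mem_coe.2
      (Finset.mem_range.2 (by have := hT p hp; omega))) fun p hp q hq hpq => ?_
    have hpq' : (p.1 : k) = q.1 := congrArg Nat.cast hpq
    have h1 : c * ((p.2 : k) - q.2) = 0 := by
      linear_combination hl p hp - hl q hq - b * hpq'
    have h2 := sub_eq_zero.1 ((mul_eq_zero.1 h1).resolve_left hc)
    exact Prod.ext hpq (Nat.cast_injective h2)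

/-- Only the three edges of the triangle contain `t + 1` exponents, and each of them passes through
one of the corners `(0, 0)` and `(0, t)`. -/
theorem card_le_of_forall_line_of_notMem {k : Type*} [Field k] [CharZero k] {t : ℕ}
    {B : Finset (ℕ × ℕ)} (hB : B ⊆ triangle (t + 1)) {a b c : k} (h0 : a ≠ 0 ∨ b ≠ 0 ∨ c ≠ 0)
    (hl : ∀ p ∈ B, a + b * p.1 + c * p.2 = 0) (h00 : (0, 0) ∉ B) (h0t : (0, t) ∉ B) :
    B.card ≤ t := by
  have hT : ∀ p ∈ B, p.1 + p.2 < t + 1 := fun p hp => mem_triangle.1 (hB hp)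
  by_contra! hcard
  by_cases hc : c = 0
  · subst hc
    by_cases hb : b = 0
    · subst hb
      have ha : a ≠ 0 := by simpa using h0
      have : B = ∅ := Finset.eq_empty_of_forall_notMem fun p hp => ha (by simpa using hl p hp)
      simp [this] at hcard
    · have hinj : Set.InjOn Prod.snd (B : Set (ℕ × ℕ)) := fun p hp q hq hpq => by
        have h1 : b * ((p.1 : k) - q.1) = 0 := by linear_combination hl p hp - hl q hq
        have h2 := sub_eq_zero.1 ((mul_eq_zero.1 h1).resolve_left hb)
        exact Prod.ext (Nat.cast_injective h2) hpq
      have himg : B.image Prod.snd = Finset.range (t + 1) := by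
        refine Finset.eq_of_subset_of_card_le (fun y hy => ?_) ?_
        · obtain ⟨p, hp, rfl⟩ := Finset.mem_image.1 hy
          exact Finset.mem_range.2 (by have := hT p hp; omega)
        · rw [Finset.card_image_of_injOn hinj, Finset.card_range]
          exact hcard
      obtain ⟨⟨y, z⟩, hp, hz : z = t⟩ := Finset.mem_image.1
        (himg ▸ Finset.mem_range.2 (Nat.lt_succ_self t))
      subst hz
      have := hT _ hp
      obtain rfl : y = 0 := by simp only at this; omega
      exact h0t hp
  · have hinj : Set.InjOn Prod.fst (B : Set (ℕ × ℕ)) := fun p hp q hq hpq => by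
      have hpq' : (p.1 : k) = q.1 := congrArg Nat.cast hpq
      have h1 : c * ((p.2 : k) - q.2) = 0 := by
        linear_combination hl p hp - hl q hq - b * hpq'
      have h2 := sub_eq_zero.1 ((mul_eq_zero.1 h1).resolve_left hc)
      exact Prod.ext hpq (Nat.cast_injective h2)
    have himg : B.image Prod.fst = Finset.range (t + 1) := by
      refine Finset.eq_of_subset_of_card_le (fun y hy => ?_) ?_
      · obtain ⟨p, hp, rfl⟩ := Finset.mem_image.1 hy
        exact Finset.mem_range.2 (by have := hT p hp; omega)
      · rw [Finset.card_image_of_injOn hinj, Finset.card_range]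
        exact hcard
    have hex : ∀ x < t + 1, ∃ y, (x, y) ∈ B := fun x hx => by
      obtain ⟨⟨x', y⟩, hp, rfl⟩ := Finset.mem_image.1 (himg ▸ Finset.mem_range.2 hx)
      exact ⟨y, hp⟩
    obtain ⟨y₀, hy₀⟩ := hex 0 (by omega)
    have hy₀0 : y₀ ≠ 0 := by rintro rfl; exact h00 hy₀
    have hy₀t : y₀ ≠ t := by rintro rfl; exact h0t hy₀
    have hy₀lt := hT _ hy₀
    obtain ⟨u, rfl⟩ : ∃ u, t = u + 1 := ⟨t - 1, by simp only at hy₀lt; omega⟩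
    obtain ⟨y₁, hy₁⟩ := hex (u + 1) (by omega)
    obtain ⟨y₂, hy₂⟩ := hex u (by omega)
    have hy₁lt := hT _ hy₁
    have hy₂lt := hT _ hy₂
    have e₀ := hl _ hy₀
    have e₁ := hl _ hy₁
    have e₂ := hl _ hy₂
    simp only at hy₁lt hy₂lt
    obtain rfl : y₁ = 0 := by omega
    push_cast at e₀ e₁ e₂
    have hy₂ : y₂ = 0 ∨ y₂ = 1 := by omega
    rcases hy₂ with rfl | rfl
    · have h1 : c * (y₀ : k) = 0 := by
        push_cast at e₂
        linear_combination e₀ + u * e₁ - (u + 1) * e₂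
      rcases mul_eq_zero.1 h1 with h | h
      · exact hc h
      · exact hy₀0 (by exact_mod_cast h)
    · have h1 : c * ((y₀ : k) - (u + 1)) = 0 := by
        push_cast at e₂
        linear_combination e₀ + u * e₁ - (u + 1) * e₂
      rcases mul_eq_zero.1 h1 with h | h
      · exact hc h
      · refine hy₀t ?_
        have h2 := sub_eq_zero.1 h
        exact_mod_cast h2

/-! ### Configurations of translated germs -/

theorem isFormalIso_frame {k : Type*} [Field k] (P : k × k) :
    IsFormalIso (frame ![1, P.1, P.2]) := by
  have hne : (Finsupp.single (0 : Fin 2) 1 : Fin 2 →₀ ℕ) ≠ Finsupp.single 1 1 := by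
    intro h
    have := DFunLike.congr_fun h 0
    simp at this
  rw [IsFormalIso, Fintype.linearIndependent_iff]
  intro g hg
  have h0 := congrFun hg 0
  have h1 := congrFun hg 1
  have h2 := congrFun hg 2
  simp [Fin.sum_univ_three, frame, MvPowerSeries.coeff_C, MvPowerSeries.coeff_X,
    MvPowerSeries.coeff_one, hne, hne.symm]
    at h0 h1 h2
  intro i
  fin_cases i
  · exact h0
  · simpa [h0] using h1
  · simpa [h0] using h2

/-- Homogenization identifies the polynomials of degree at most `t` with the forms of degree `t`. -/
theorem exists_form_aeval_frame {k : Type*} [Field k] {t : ℕ} {f : ℕ × ℕ →₀ k}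
    (hf : f ∈ Finsupp.supported k k (triangle (t + 1) : Set (ℕ × ℕ))) :
    ∃ H : MvPolynomial (Fin 3) k, H.IsHomogeneous t ∧ ∀ P : k × k,
      MvPolynomial.aeval (frame ![1, P.1, P.2]) H = translate P f := by
  refine ⟨∑ q ∈ f.support, MvPolynomial.C (f q) * (MvPolynomial.X 0 ^ (t - q.1 - q.2) *
    MvPolynomial.X 1 ^ q.1 * MvPolynomial.X 2 ^ q.2), ?_, fun P => ?_⟩
  · refine MvPolynomial.IsHomogeneous.sum _ _ _ fun q hq => ?_
    have hq' := mem_triangle.1 ((Finsupp.mem_supported k f).1 hf hq)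
    have hX : ∀ (i : Fin 3) n, (MvPolynomial.X i ^ n : MvPolynomial (Fin 3) k).IsHomogeneous n :=
      fun i n => by simpa using (MvPolynomial.isHomogeneous_X k i).pow n
    have h1 := (((hX 0 (t - q.1 - q.2)).mul (hX 1 q.1)).mul (hX 2 q.2)).C_mul (f q)
    have h2 : t - q.1 - q.2 + q.1 + q.2 = t := by omega
    rwa [h2] at h1
  · rw [translate, Finsupp.linearCombination_apply, Finsupp.sum, map_sum]
    refine Finset.sum_congr rfl fun q _ => ?_
    rw [MvPowerSeries.smul_eq_C_mul]
    simp [frame, MvPowerSeries.algebraMap_apply, add_comm]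

/-! ### Existence of one good union -/

/-- There is room for a subscheme of multiplicity `n` and length `ℓ`, even after all others have
been placed. Here `D + L` is the number of monomials of degree at most `t`, and `L` is the total
length. -/
theorem room_of_bounds {t e m n ℓ L D : ℕ} (ht : 0 < t) (he : 0 < e) (hm : 2 ≤ m)
    (hlen : 2 * (1 + 3 * e + L) ≤ (t + 2) * (t + 1)) (hD : 2 * (D + L) = (t + 2) * (t + 1))
    (hdouble : (m - 1) * (t - 1) ≤ 2 * e) (hnm : n ≤ m) (hnℓ : n ≤ ℓ) (hℓ : ℓ ≤ L) :
    (n - 1) * (t + 1) < D + ℓ ∧ n ≤ t + 1 := by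
  obtain ⟨u, rfl⟩ : ∃ u, t = u + 1 := ⟨t - 1, by omega⟩
  rcases Nat.eq_zero_or_pos n with rfl | hn
  · refine ⟨?_, by omega⟩
    simp only [Nat.zero_sub, zero_mul]
    omega
  obtain ⟨p, rfl⟩ : ∃ p, n = p + 1 := ⟨n - 1, by omega⟩
  have h1 : p * u ≤ 2 * e :=
    (Nat.mul_le_mul_right u (show p ≤ m - 1 by omega)).trans hdouble
  have hDe : 3 * e + 1 ≤ D := by omega
  have h2 : p * (u + 1 + 1) < D + ℓ := by
    rcases Nat.lt_or_ge u 2 with hu | hu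
    · interval_cases u
      · omega
      · have : p ≤ 1 := by omega
        interval_cases p <;> omega
    · have h3 : p * 2 ≤ p * u := Nat.mul_le_mul_left p hu
      have h4 : p * (u + 1 + 1) = p * u + p * 2 := by ring
      omega
  refine ⟨h2, ?_⟩
  by_contra! hlt
  have h3 : (u + 2) * (u + 1 + 1) ≤ p * (u + 1 + 1) := Nat.mul_le_mul_right _ (by omega)
  have h4 : 2 * ((u + 2) * (u + 1 + 1)) < (u + 1 + 2) * (u + 1 + 1) := by omega
  nlinarith

/-- Outside any line there are enough exponents for `e` double points: either there are many
exponents in all, or no edge of the triangle is full. -/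
theorem le_card_filter_line {k : Type*} [Field k] [CharZero k] [DecidableEq k] {t e D : ℕ}
    {A : Finset (ℕ × ℕ)} (hA : A ⊆ triangle (t + 1)) (hDA : D ≤ A.card) (hDe : 3 * e + 1 ≤ D)
    (hte : t ≤ 2 * e + 1) (hcorner : D ≤ e + t → (0, 0) ∉ A ∧ (0, t) ∉ A) {a b c : k}
    (h0 : a ≠ 0 ∨ b ≠ 0 ∨ c ≠ 0) :
    e ≤ (A.filter fun p => a + b * p.1 + c * p.2 ≠ 0).card := by
  have h1 := Finset.card_filter_add_card_filter_not (s := A)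
    (fun p => a + b * p.1 + c * p.2 = 0)
  have h2 := card_le_of_forall_line ((Finset.filter_subset _ _).trans hA) h0
    (B := A.filter fun p => a + b * p.1 + c * p.2 = 0) fun p hp => (Finset.mem_filter.1 hp).2
  simp only [ne_eq]
  rcases Nat.lt_or_ge (e + t) D with h | h
  · omega
  · have h3 := card_le_of_forall_line_of_notMem ((Finset.filter_subset _ _).trans hA) h0
      (B := A.filter fun p => a + b * p.1 + c * p.2 = 0) (fun p hp => (Finset.mem_filter.1 hp).2)
      (fun hp => (hcorner h).1 (Finset.mem_filter.1 hp).1)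
      (fun hp => (hcorner h).2 (Finset.mem_filter.1 hp).1)
    omega

/-- A condition at the origin excludes constant terms. -/
theorem zero_notMem_initials {k : Type*} [Field k] {t : ℕ} {V : Submodule k (ℕ × ℕ →₀ k)}
    {I : Ideal (MvPowerSeries (Fin 2) k)} (hI : I ≠ ⊤) (hV : ∀ f ∈ V, translate (0, 0) f ∈ I) :
    (0, 0) ∉ initials t V := by
  intro h
  obtain ⟨-, f, hf, hf1, -⟩ := mem_initials.1 h
  have h1 := IsLocalRing.le_maximalIdeal hI (hV f hf)
  rw [← pow_one (IsLocalRing.maximalIdeal _), mem_maximalIdeal_pow_iff_triangle] at h1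
  have h2 := h1 (0, 0) (by simp [mem_triangle])
  rw [coeff_translate_zero, hf1] at h2
  exact one_ne_zero h2

/-- The monomial of greatest weight does not vanish at points outside the line `y = 0`. -/
theorem notMem_initials_of_ne_zero {k : Type*} [Field k] {t : ℕ} {V : Submodule k (ℕ × ℕ →₀ k)}
    (hVT : V ≤ Finsupp.supported k k (triangle (t + 1) : Set (ℕ × ℕ)))
    {I : Ideal (MvPowerSeries (Fin 2) k)} (hI : I ≠ ⊤) {P : k × k} (hP : P.2 ≠ 0)
    (hV : ∀ f ∈ V, translate P f ∈ I) : (0, t) ∉ initials t V := by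
  intro h
  obtain ⟨hT, f, hf, hf1, hf0⟩ := mem_initials.1 h
  have h1 := IsLocalRing.le_maximalIdeal hI (hV f hf)
  rw [← pow_one (IsLocalRing.maximalIdeal _), mem_maximalIdeal_pow_iff_triangle] at h1
  have h2 := h1 (0, 0) (by simp [mem_triangle])
  rw [coeff_translate_of_mem _ _ (hVT hf), Finset.sum_eq_single (0, t)] at h2
  · simp [jet, hf1, hP] at h2
  · intro q hq hne
    have hq' := mem_triangle.1 hq
    have hw : weight t q ≤ weight t (0, t) := by
      rw [weight_eq, weight_eq]
      have := Nat.mul_le_mul_left (t + 1) (show q.1 + q.2 ≤ 0 + t by omega)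
      simp only at this ⊢
      omega
    rw [hf0 q (lt_of_le_of_ne hw fun h => hne (weight_injOn hq hT h)), zero_mul]
  · exact fun h => absurd hT h

end FatPoints

open FatPoints in
theorem theorem0p3 {k : Type*} [Field k] [IsAlgClosed k] [CharZero k]
    (t r e : ℕ) (ht : 0 < t) (hr : 0 < r) (he : 0 < e)
    (Z : Fin r → Ideal (MvPowerSeries (Fin 2) k)) (hZ : ∀ i, IsZeroDimGerm (Z i))
    (m : ℕ) (hm : m = max (Finset.univ.sup fun i => germMult (Z i)) 2)
    (h_length : 1 + 3 * (e : ℚ) + ∑ i, (germLength (Z i) : ℚ) ≤ ((t : ℚ) + 2) * ((t : ℚ) + 1) / 2)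
    (h_double : ((m : ℚ) - 1) * ((t : ℚ) - 1) / 2 ≤ (e : ℚ)) :
    ForGeneral fun c : Configuration k e r => h1 (c.unionIdeal Z) t = 0 := by
  classical
  obtain ⟨r, rfl⟩ : ∃ r', r = r' + 1 := ⟨r - 1, by omega⟩
  have hm2 : 2 ≤ m := hm ▸ le_max_right _ _
  have hnm : ∀ i, germMult (Z i) ≤ m := fun i =>
    (Finset.le_sup (f := fun i => germMult (Z i)) (Finset.mem_univ i)).trans (hm ▸ le_max_left _ _)
  set L := ∑ i, germLength (Z i) with hL
  have hlen : 2 * (1 + 3 * e + L) ≤ (t + 2) * (t + 1) := by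
    have : (2 * (1 + 3 * e + L) : ℚ) ≤ (t + 2) * (t + 1) := by
      rw [hL]; push_cast; linarith
    exact_mod_cast this
  have hdouble : (m - 1) * (t - 1) ≤ 2 * e := by
    have : (((m - 1 : ℕ) : ℚ) * ((t - 1 : ℕ) : ℚ)) ≤ 2 * e := by
      rw [Nat.cast_sub (by omega), Nat.cast_sub (by omega)]; push_cast; linarith
    exact_mod_cast this
  have hcard : 2 * (triangle (t + 1)).card = (t + 2) * (t + 1) := by
    rw [card_triangle]; ring
  obtain ⟨D, hD⟩ : ∃ D, (triangle (t + 1)).card = D + L :=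
    ⟨(triangle (t + 1)).card - L, by omega⟩
  have hD2 : 2 * (D + L) = (t + 2) * (t + 1) := by rw [← hD, hcard]
  have hDe : 3 * e + 1 ≤ D := by omega
  have hpow := fun i => maximalIdeal_pow_germMult_le (hZ i)
  have hroom := fun i => room_of_bounds ht he hm2 hlen hD2 hdouble (hnm i)
    (germMult_le_germLength (hZ i))
    (Finset.single_le_sum (f := fun i => germLength (Z i)) (fun _ _ => Nat.zero_le _)
      (Finset.mem_univ i))
  set T := Finsupp.supported k k (triangle (t + 1) : Set (ℕ × ℕ)) with hT
  have hfinT : Module.Finite k T := finite_supported _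
  have hrankT : Module.finrank k T = D + L := by rw [hT, finrank_supported, hD]
  -- the first subscheme at the origin, the others in the torus
  have h₀ : Imposes T (fun _ : Unit => (0, 0)) fun _ => Z 0 := imposes_origin (hroom 0).2 (hpow 0)
  have hdim₀ := finrank_le_finrank_vanishing_add T (fun _ : Unit => (0, 0)) (fun _ => Z 0)
    fun _ => (hZ 0).2
  rw [Fintype.sum_unique, hrankT, hL, Fin.sum_univ_succ] at hdim₀
  obtain ⟨P, hP, hPZ⟩ := exists_imposes_of_finrank (D := D) r
    (vanishing T (fun _ : Unit => (0, 0)) fun _ => Z 0) (fun i => Z i.succ)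
    (fun i => germMult (Z i.succ)) (vanishing_le _ _ _) (fun i => hpow i.succ) (by omega)
    fun i => (hroom i.succ).1
  set P' : Fin (r + 1) → k × k := Fin.cons (0, 0) P with hP'
  have hPZ' : Imposes T P' Z := Imposes.cons h₀ hPZ
  have hdim := finrank_le_finrank_vanishing_add T P' Z fun i => (hZ i).2
  rw [hrankT, ← hL] at hdim
  set V := vanishing T P' Z with hV
  have hVT : V ≤ T := vanishing_le _ _ _
  have hDV : D ≤ Module.finrank k V := by omega
  -- the double points
  have hut : t - 1 ≤ 2 * e := le_trans (Nat.le_mul_of_pos_left _ (by omega)) hdouble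
  obtain ⟨Q, hQ⟩ := exists_imposes_double e V hVT (hDe.trans hDV) fun a b c h0 => by
    refine le_card_filter_line (fun p hp => (mem_initials.1 hp).1)
      (hDV.trans (finrank_le_card_initials hVT)) hDe (by omega) (fun htight => ?_) h0
    refine ⟨zero_notMem_initials (hZ 0).1 fun f hf => hf.2 0, ?_⟩
    have hte : t = 2 * e + 1 := by omega
    rcases Nat.eq_zero_or_pos r with rfl | hr
    · -- a single subscheme of multiplicity at most two is too short for the bounds to be attained
      exfalso
      have hm2' : m = 2 := by
        by_contra hne
        have h2 := (Nat.mul_le_mul_right (t - 1) (show 2 ≤ m - 1 by omega)).trans hdouble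
        omega
      have h3 := (finite_quotient_of_maximalIdeal_pow_le (n := 2)
        ((Ideal.pow_le_pow_right (hm2' ▸ hnm 0)).trans (hpow 0))).2
      have h4 : (triangle 2).card = 3 := by decide
      rw [h4] at h3
      have h5 : L ≤ 3 := by
        rw [hL]
        simpa [germLength] using h3
      subst hte
      nlinarith
    · exact notMem_initials_of_ne_zero hVT (hZ (Fin.succ ⟨0, hr⟩)).1 (hP ⟨0, hr⟩)
        fun f hf => hf.2 (Fin.succ ⟨0, hr⟩)
  have hall := hPZ'.sum hQ
  let c₀ : Configuration k e (r + 1) :=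
    { point := fun j => ![1, (Q j).1, (Q j).2]
      point_ne_zero := fun j h => one_ne_zero (congrFun h 0)
      iso := fun i => frame ![1, (P' i).1, (P' i).2]
      isFormalIso := fun i => isFormalIso_frame _ }
  refine forGeneral_of_exists (fun i => ⟨_, hpow i⟩) c₀ (fun j => one_ne_zero) fun g => ?_
  obtain ⟨f, hf, hfg⟩ := hall (Sum.elim (fun i => g (Sum.inr i)) fun j => g (Sum.inl j))
  obtain ⟨H, hH, hHf⟩ := exists_form_aeval_frame hf
  refine ⟨H, hH, ?_⟩
  rintro (j | i)
  · have h2 := hfg (Sum.inr j)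
    rw [← hHf] at h2
    exact h2
  · have h2 := hfg (Sum.inl i)
    rw [← hHf] at h2
    exact h2
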